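/- Let $a<b$, $\Omega=[a,b]$ with $a$ and $b$ identified, $q\ge 1$ an integer, $\gamma=\lfloor q/2\rfloor$, $\beta\in\mathbb R$, and $L=\beta\partial_x^q$. Norms and inner products without index are those of $L^2(\Omega)$; operator norms on $V_h$ are the induced ones; $\|\cdot\|_m$ is the norm of $H^m(\Omega)$. *Spatial discretization.* For a mesh $a=x_{1/2}<x_{3/2}<\dots<x_{N+1/2}=b$ with cells $I_j=[x_{j-1/2},x_{j+1/2}]$, mesh size $h=\max_j|I_j|$, quasi-uniform with constant $\rho$ (that is, $|I_i|\le\rho|I_j|$ for all $i,j$), let $V_h$ be the space of functions whose restriction to each $I_j$ is a polynomial of degree at most $k$, $k\ge0$. With $v^\pm$ the right and left limits at the (periodic) interfaces and $[v]=v^+-v^-$, define $D_{h,\theta}:V_h\to V_h$ by $$(D_{h,\theta}w,v)=-\sum_j\int_{I_j}w\,\partial_xv\,dx-\sum_j\bigl(\theta w^-+(1-\theta)w^+\bigr)_{j+\frac12}[v]_{j+\frac12}\qquad\forall v,w\in V_h .$$ Let $\theta_1,\dots,\theta_\gamma$ and, if $q$ is odd, $\theta_0$ be real numbers, all different from $\tfrac12$.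 Put $K_h=D_{h,\theta_1}\cdots D_{h,\theta_\gamma}$ and $$L_h=(-1)^\gamma\beta K_h^\top K_h\ \ (q=2\gamma),\qquad L_h=(-1)^\gamma\beta K_h^\top D_{h,\theta_0}K_h\ \ (q=2\gamma+1);$$ equivalently $L_h=\beta D_{h,1-\theta_\gamma}\cdots D_{h,1-\theta_1}(D_{h,\theta_0})D_{h,\theta_1}\cdots D_{h,\theta_\gamma}$, the factor in parentheses being present only for odd $q$. *Projection.* For $\theta\ne\frac12$ let $D_{h,\theta}^{-1}$ be the inverse of $D_{h,\theta}$ on $Z_h=\{v\in V_h:(v,1)=0\}$, let $\Pi_0$ be the $L^2$ projection onto $V_h$, and $$\Pi w=\bigl(D_{h,\theta_\gamma}^{-1}\cdots D_{h,\theta_1}^{-1}\bigr)\bigl(D_{h,\theta_0}^{-1}\bigr)\bigl(D_{h,1-\theta_1}^{-1}\cdots D_{h,1-\theta_\gamma}^{-1}\bigr)\Pi_0\partial_x^qw+\frac{(w,1)}{(1,1)},$$ with $D_{h,\theta_0}^{-1}$ present only for odd $q$. *Time discretization.* Let $1\le p\le s$, $\alpha_0,\dots,\alpha_s\in\mathbb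 R$ with $\alpha_i=1/i!$ for $i\le p$, and $R_s(\tau L_h)=\sum_{i=0}^s\alpha_i(\tau L_h)^i$. The fully discrete scheme is $u_h^0=\Pi u(0)$, $u_h^{n+1}=R_s(\tau L_h)u_h^n$, with $t^n=n\tau$. *Claim.* For every $M$ there is a constant $C>0$ that depends only on $a,b,q,\beta,\theta_0,\dots,\theta_\gamma,k,s,p,(\alpha_i),\rho$ and $M$ such that the following holds. Let $m=k+1+q(p+2)$ and let $u$ be a solution of $\partial_tu=\beta\partial_x^qu$ on $[0,T]\times\mathbb R$, $(b-a)$-periodic and of class $C^m$ in $x$, with $\partial_t^iu=L^iu$ for $1\le i\le p+1$ and $\|u(t)\|_m\le M$ for all $t\in[0,T]$. For every mesh as above, every $0<\tau\le1$ with $\tau\|L_h\|\le\lambda$ for some $\lambda<1$, and every $\mu_h\ge0$ for which the fully discrete scheme is stable in the sense that $\|R_s(\tau L_h)\|\le1+\mu_h\tau$, one has for all $n\ge0$ with $t^n\le T$ $$\|u(t^n)-u_h^n\|\le C\bigl(\sigma(\mu_h,t^n)+1\bigr)\bigl(h^{k+1}+\tau^p\bigr),\qquad \sigma(\mu,t)=\frac{e^{\mu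 t}-1}{\mu}\ (\mu>0),\quad\sigma(0,t)=t .$$ -/

import Mathlib

open Set
open scoped Polynomial InnerProductSpace

noncomputable section

namespace LDG

/-! ### Meshes of the periodic interval -/

/-- A partition `a = x₀ < x₁ < ⋯ < x_N = b`, `N ≥ 1`, of the interval `Ω = [a, b]`, whose end points
are identified. The cells are `I_j = [x_j, x_{j+1}]`, `j : Fin N`. -/
structure Mesh (a b : ℝ) where
  N : ℕ
  N_pos : 0 < N
  x : Fin (N + 1) → ℝ
  strictMono : StrictMono x
  x_first : x 0 = a
  x_last : x (Fin.last N) = b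

namespace Mesh

variable {a b : ℝ} (T : Mesh a b)

instance : NeZero T.N := ⟨T.N_pos.ne'⟩

/-- Left end point of the cell `I_j`. -/
def left (j : Fin T.N) : ℝ := T.x j.castSucc

/-- Right end point of the cell `I_j`. -/
def right (j : Fin T.N) : ℝ := T.x j.succ

lemma left_lt_right (j : Fin T.N) : T.left j < T.right j :=
  T.strictMono (Fin.castSucc_lt_succ)

/-- Mesh size: the largest cell length. -/
def h : ℝ := ⨆ j : Fin T.N, (T.right j - T.left j)

/-- Quasi-uniformity with constant `ρ`: any two cell lengths have ratio at most `ρ`. -/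
def QuasiUniform (ρ : ℝ) : Prop :=
  ∀ i j : Fin T.N, T.right i - T.left i ≤ ρ * (T.right j - T.left j)

end Mesh

/-! ### The finite element space -/

/-- The space `V_h` of piecewise polynomials of degree at most `k`: one polynomial for each cell. -/
def Vh {a b : ℝ} (T : Mesh a b) (k : ℕ) : Type := Fin T.N → Polynomial.degreeLT ℝ (k + 1)

namespace Vh

variable {a b : ℝ} {T : Mesh a b} {k : ℕ}

instance : AddCommGroup (Vh T k) :=
  inferInstanceAs (AddCommGroup (Fin T.N → Polynomial.degreeLT ℝ (k + 1)))

instance : Module ℝ (Vh T k) :=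
  inferInstanceAs (Module ℝ (Fin T.N → Polynomial.degreeLT ℝ (k + 1)))

/-- The polynomial that represents `v` on the cell `I_j`. -/
def poly (v : Vh T k) (j : Fin T.N) : ℝ[X] := (v j : ℝ[X])

@[simp] lemma poly_add (v w : Vh T k) (j : Fin T.N) : (v + w).poly j = v.poly j + w.poly j := rfl

@[simp] lemma poly_smul (c : ℝ) (v : Vh T k) (j : Fin T.N) : (c • v).poly j = c • v.poly j := rfl

@[simp] lemma poly_zero (j : Fin T.N) : (0 : Vh T k).poly j = 0 := rfl

lemma ext_poly {v w : Vh T k} (h : ∀ j, v.poly j = w.poly j) : v = w :=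
  funext fun j => Subtype.ext (h j)

instance : FiniteDimensional ℝ (Vh T k) := by
  have : FiniteDimensional ℝ (Polynomial.degreeLT ℝ (k + 1)) :=
    LinearEquiv.finiteDimensional (Polynomial.degreeLTEquiv ℝ (k + 1)).symm
  exact inferInstanceAs (FiniteDimensional ℝ (Fin T.N → Polynomial.degreeLT ℝ (k + 1)))

lemma poly_eq_zero_of_integral {l r : ℝ} (hlr : l < r) (p : ℝ[X])
    (h : ∫ x in l..r, p.eval x * p.eval x = 0) : p = 0 := by
  by_contra hp
  have hne : ∃ c ∈ Ioo l r, p.eval c ≠ 0 := by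
    by_contra hcon
    push Not at hcon
    exact hp (Polynomial.eq_zero_of_infinite_isRoot p
      ((Ioo_infinite hlr).mono fun c hc => hcon c hc))
  obtain ⟨c, hc, hc0⟩ := hne
  have hpos : 0 < ∫ x in l..r, p.eval x * p.eval x :=
    intervalIntegral.integral_pos hlr
      (Continuous.continuousOn (by fun_prop)) (fun x _ => mul_self_nonneg _)
      ⟨c, Ioo_subset_Icc_self hc, mul_self_pos.mpr hc0⟩
  exact hpos.ne' h

/-- The `L²(Ω)` inner product `∑_j ∫_{I_j} v w dx` on `V_h`. -/
@[reducible] def innerCore : InnerProductSpace.Core ℝ (Vh T k) where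
  inner v w := ∑ j, ∫ x in (T.left j)..(T.right j), (v.poly j).eval x * (w.poly j).eval x
  conj_inner_symm v w := by
    simp [mul_comm]
  re_inner_nonneg v := by
    simp only [RCLike.re_to_real]
    exact Finset.sum_nonneg fun j _ =>
      intervalIntegral.integral_nonneg (T.left_lt_right j).le fun x _ => mul_self_nonneg _
  add_left u v w := by
    rw [← Finset.sum_add_distrib]
    refine Finset.sum_congr rfl fun j _ => ?_
    rw [← intervalIntegral.integral_add]
    · simp [add_mul]
    · exact Continuous.intervalIntegrable (by fun_prop) _ _
    · exact Continuous.intervalIntegrable (by fun_prop) _ _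
  smul_left v w c := by
    simp [Finset.mul_sum, mul_assoc]
  definite v hv := by
    have h0 := (Finset.sum_eq_zero_iff_of_nonneg fun j _ =>
      intervalIntegral.integral_nonneg (T.left_lt_right j).le
        fun x _ => mul_self_nonneg ((v.poly j).eval x)).mp hv
    exact ext_poly fun j => by
      simpa using poly_eq_zero_of_integral (T.left_lt_right j) _ (h0 j (Finset.mem_univ j))

instance : NormedAddCommGroup (Vh T k) :=
  @InnerProductSpace.Core.toNormedAddCommGroup ℝ (Vh T k) _ _ _ innerCore

instance : InnerProductSpace ℝ (Vh T k) :=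
  InnerProductSpace.ofCore innerCore.toCore

lemma inner_def (v w : Vh T k) :
    ⟪v, w⟫_ℝ = ∑ j, ∫ x in (T.left j)..(T.right j), (v.poly j).eval x * (w.poly j).eval x := rfl

/-- The constant function `c` as an element of `V_h`. -/
def const (c : ℝ) : Vh T k := fun _ =>
  ⟨Polynomial.C c, Polynomial.mem_degreeLT.mpr
    (lt_of_le_of_lt Polynomial.degree_C_le (by exact_mod_cast Nat.succ_pos k))⟩

/-- `Z_h`: the elements of `V_h` with zero mean. -/
def Zh (T : Mesh a b) (k : ℕ) : Set (Vh T k) := {v | ⟪v, const 1⟫_ℝ = 0}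

/-- The left limit `v⁻` at the interface `x_{j+1/2}`, the right end point of the cell `I_j`. -/
def traceMinus (v : Vh T k) (j : Fin T.N) : ℝ := (v.poly j).eval (T.right j)

/-- The right limit `v⁺` at the right end point of `I_j`, taken from the next cell. Addition in
`Fin N` is cyclic: the cell after the last one is the first one. -/
def tracePlus (v : Vh T k) (j : Fin T.N) : ℝ := (v.poly (j + 1)).eval (T.left (j + 1))

/-- The jump `[v] = v⁺ - v⁻`. -/
def jump (v : Vh T k) (j : Fin T.N) : ℝ := v.tracePlus j - v.traceMinus j

/-- The numerical flux `θ v⁻ + (1 - θ) v⁺`. -/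
def flux (θ : ℝ) (v : Vh T k) (j : Fin T.N) : ℝ := θ * v.traceMinus j + (1 - θ) * v.tracePlus j

/-- The form `-(w, ∂ₓ v) - ∑_j ŵ_{j+1/2} [v]_{j+1/2}`. -/
def dgForm (θ : ℝ) (w v : Vh T k) : ℝ :=
  -(∑ j, ∫ x in (T.left j)..(T.right j), (w.poly j).eval x * (v.poly j).derivative.eval x)
    - ∑ j, w.flux θ j * v.jump j

lemma dgForm_add_left (θ : ℝ) (w w' v : Vh T k) :
    dgForm θ (w + w') v = dgForm θ w v + dgForm θ w' v := by
  have h1 : ∀ j, (∫ x in (T.left j)..(T.right j),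
      ((w + w').poly j).eval x * (v.poly j).derivative.eval x) =
      (∫ x in (T.left j)..(T.right j), (w.poly j).eval x * (v.poly j).derivative.eval x) +
      ∫ x in (T.left j)..(T.right j), (w'.poly j).eval x * (v.poly j).derivative.eval x := by
    intro j
    rw [← intervalIntegral.integral_add]
    · simp [add_mul]
    · exact Continuous.intervalIntegrable (by fun_prop) _ _
    · exact Continuous.intervalIntegrable (by fun_prop) _ _
  have h2 : ∀ j, (w + w').flux θ j * v.jump j = w.flux θ j * v.jump j + w'.flux θ j * v.jump j := by
    intro j
    simp only [flux, traceMinus, tracePlus, poly_add, Polynomial.eval_add]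
    ring
  simp only [dgForm, h1, h2, Finset.sum_add_distrib]
  ring

lemma dgForm_smul_left (θ c : ℝ) (w v : Vh T k) :
    dgForm θ (c • w) v = c * dgForm θ w v := by
  have h1 : ∀ j, (∫ x in (T.left j)..(T.right j),
      ((c • w).poly j).eval x * (v.poly j).derivative.eval x) =
      c * ∫ x in (T.left j)..(T.right j), (w.poly j).eval x * (v.poly j).derivative.eval x := by
    intro j
    simp [mul_assoc]
  have h2 : ∀ j, (c • w).flux θ j * v.jump j = c * (w.flux θ j * v.jump j) := by
    intro j
    simp only [flux, traceMinus, tracePlus, poly_smul, Polynomial.eval_smul, smul_eq_mul]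
    ring
  simp only [dgForm, h1, h2, ← Finset.mul_sum]
  ring

lemma dgForm_add_right (θ : ℝ) (w v v' : Vh T k) :
    dgForm θ w (v + v') = dgForm θ w v + dgForm θ w v' := by
  have h1 : ∀ j, (∫ x in (T.left j)..(T.right j),
      (w.poly j).eval x * ((v + v').poly j).derivative.eval x) =
      (∫ x in (T.left j)..(T.right j), (w.poly j).eval x * (v.poly j).derivative.eval x) +
      ∫ x in (T.left j)..(T.right j), (w.poly j).eval x * (v'.poly j).derivative.eval x := by
    intro j
    rw [← intervalIntegral.integral_add]
    · simp [mul_add]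
    · exact Continuous.intervalIntegrable (by fun_prop) _ _
    · exact Continuous.intervalIntegrable (by fun_prop) _ _
  have h2 : ∀ j, w.flux θ j * (v + v').jump j = w.flux θ j * v.jump j + w.flux θ j * v'.jump j := by
    intro j
    simp only [jump, traceMinus, tracePlus, poly_add, Polynomial.eval_add]
    ring
  simp only [dgForm, h1, h2, Finset.sum_add_distrib]
  ring

lemma dgForm_smul_right (θ c : ℝ) (w v : Vh T k) :
    dgForm θ w (c • v) = c * dgForm θ w v := by
  have h1 : ∀ j, (∫ x in (T.left j)..(T.right j),
      (w.poly j).eval x * ((c • v).poly j).derivative.eval x) =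
      c * ∫ x in (T.left j)..(T.right j), (w.poly j).eval x * (v.poly j).derivative.eval x := by
    intro j
    rw [← intervalIntegral.integral_const_mul]
    simp [mul_left_comm]
  have h2 : ∀ j, w.flux θ j * (c • v).jump j = c * (w.flux θ j * v.jump j) := by
    intro j
    simp only [jump, traceMinus, tracePlus, poly_smul, Polynomial.eval_smul, smul_eq_mul]
    ring
  simp only [dgForm, h1, h2, ← Finset.mul_sum]
  ring

/-- The form `dgForm θ w ·` as a linear functional on `V_h`. -/
def dgFunctional (θ : ℝ) (w : Vh T k) : Vh T k →ₗ[ℝ] ℝ where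
  toFun v := dgForm θ w v
  map_add' := dgForm_add_right θ w
  map_smul' c v := by simpa using dgForm_smul_right θ c w v

/-- The Riesz representative in `V_h` of a linear functional on `V_h`. -/
def riesz (ℓ : Vh T k →ₗ[ℝ] ℝ) : Vh T k :=
  haveI := FiniteDimensional.complete ℝ (Vh T k)
  (InnerProductSpace.toDual ℝ (Vh T k)).symm (LinearMap.toContinuousLinearMap ℓ)

lemma inner_riesz (ℓ : Vh T k →ₗ[ℝ] ℝ) (v : Vh T k) : ⟪riesz ℓ, v⟫_ℝ = ℓ v := by
  have := FiniteDimensional.complete ℝ (Vh T k)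
  simp [riesz]

/-- The discontinuous Galerkin operator `D_{h,θ} : V_h → V_h` approximating `∂ₓ`. -/
def D (T : Mesh a b) (k : ℕ) (θ : ℝ) : Vh T k →ₗ[ℝ] Vh T k where
  toFun w := riesz (dgFunctional θ w)
  map_add' w w' := by
    refine ext_inner_right ℝ fun v => ?_
    rw [inner_add_left, inner_riesz, inner_riesz, inner_riesz]
    exact dgForm_add_left θ w w' v
  map_smul' c w := by
    refine ext_inner_right ℝ fun v => ?_
    rw [RingHom.id_apply, real_inner_smul_left, inner_riesz, inner_riesz]
    exact dgForm_smul_left θ c w v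

/-- The variational identity that determines `D_{h,θ}`. -/
lemma inner_D (θ : ℝ) (w v : Vh T k) : ⟪D T k θ w, v⟫_ℝ = dgForm θ w v :=
  inner_riesz _ v

/-- The inverse of `D_{h,θ} : Z_h → Z_h`: the value at `y` is the element of `Z_h` that
`D_{h,θ}` maps to `y`. -/
def Dinv (θ : ℝ) (y : Vh T k) : Vh T k := Function.invFunOn (D T k θ) (Zh T k) y

/-- `K_h = D_{h,θ₁} D_{h,θ₂} ⋯ D_{h,θ_γ}`. -/
def K (T : Mesh a b) (k : ℕ) {γ : ℕ} (θ : Fin γ → ℝ) : Module.End ℝ (Vh T k) :=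
  (List.ofFn fun i => D T k (θ i)).prod

/-- The operator `L_h` approximating `β ∂ₓ^q`: with `γ = ⌊q/2⌋`, it is
`(-1)^γ β K_hᵀ K_h` if `q = 2γ` and `(-1)^γ β K_hᵀ D_{h,θ₀} K_h` if `q = 2γ + 1`.
As `K_hᵀ = (-1)^γ D_{h,1-θ_γ} ⋯ D_{h,1-θ₁}`, the sign makes it equal to
`β D_{h,1-θ_γ} ⋯ D_{h,1-θ₁} (D_{h,θ₀}) D_{h,θ₁} ⋯ D_{h,θ_γ}`. -/
def Lh (T : Mesh a b) (k q : ℕ) (β θ₀ : ℝ) (θ : Fin (q / 2) → ℝ) : Module.End ℝ (Vh T k) :=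
  ((-1) ^ (q / 2) * β) •
    (if Even q then LinearMap.adjoint (K T k θ) * K T k θ
      else LinearMap.adjoint (K T k θ) * D T k θ₀ * K T k θ)

/-- The Runge-Kutta operator `R_s(τ A) = ∑_{i=0}^s α_i (τ A)^i`. -/
def R (s : ℕ) (α : ℕ → ℝ) (τ : ℝ) (A : Module.End ℝ (Vh T k)) : Module.End ℝ (Vh T k) :=
  ∑ i ∈ Finset.range (s + 1), α i • (τ • A) ^ i

/-- The operator norm on `V_h` induced by the `L²` norm. -/
def opNorm (A : Module.End ℝ (Vh T k)) : ℝ := ‖LinearMap.toContinuousLinearMap A‖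

/-! ### Projections and the `L²` error -/

/-- The `L²(Ω)` pairing of a function with an element of `V_h`. -/
def pairing (w : ℝ → ℝ) (v : Vh T k) : ℝ :=
  ∑ j, ∫ x in (T.left j)..(T.right j), w x * (v.poly j).eval x

/-- The `L²` projection `Π₀` onto `V_h`, written in an orthonormal basis of `V_h`. -/
def proj0 (T : Mesh a b) (k : ℕ) (w : ℝ → ℝ) : Vh T k :=
  ∑ i, pairing w (stdOrthonormalBasis ℝ (Vh T k) i) • stdOrthonormalBasis ℝ (Vh T k) i

/-- The identity that determines `Π₀ w`. -/
lemma inner_proj0 {w : ℝ → ℝ} (hw : Continuous w) (v : Vh T k) :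
    ⟪proj0 T k w, v⟫_ℝ = pairing w v := by
  have hadd : ∀ v v' : Vh T k, pairing w (v + v') = pairing w v + pairing w v' := by
    intro v v'
    rw [pairing, pairing, pairing, ← Finset.sum_add_distrib]
    refine Finset.sum_congr rfl fun j _ => ?_
    rw [← intervalIntegral.integral_add]
    · simp [mul_add]
    · exact Continuous.intervalIntegrable (by fun_prop) _ _
    · exact Continuous.intervalIntegrable (by fun_prop) _ _
  have hsmul : ∀ (c : ℝ) (v : Vh T k), pairing w (c • v) = c * pairing w v := by
    intro c v
    rw [pairing, pairing, Finset.mul_sum]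
    refine Finset.sum_congr rfl fun j _ => ?_
    rw [← intervalIntegral.integral_const_mul]
    simp [mul_left_comm]
  let ℓ : Vh T k →ₗ[ℝ] ℝ :=
    { toFun := pairing w, map_add' := hadd, map_smul' := fun c v => by simpa using hsmul c v }
  have h1 : ℓ v = ℓ (∑ i, ⟪stdOrthonormalBasis ℝ (Vh T k) i, v⟫_ℝ •
      stdOrthonormalBasis ℝ (Vh T k) i) := by
    rw [OrthonormalBasis.sum_repr']
  change _ = ℓ v
  rw [h1, map_sum, proj0, sum_inner]
  refine Finset.sum_congr rfl fun i _ => ?_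
  rw [map_smul, real_inner_smul_left, smul_eq_mul, mul_comm]
  rfl

/-- The operator `Π`, with `γ = ⌊q/2⌋`:
`(D_{h,θ_γ}⁻¹ ⋯ D_{h,θ₁}⁻¹) (D_{h,θ₀}⁻¹) (D_{h,1-θ₁}⁻¹ ⋯ D_{h,1-θ_γ}⁻¹) Π₀ ∂ₓ^q w + (w,1)/(1,1)`,
where the factor `D_{h,θ₀}⁻¹` is present only if `q` is odd. -/
def proj (T : Mesh a b) (k q : ℕ) (θ₀ : ℝ) (θ : Fin (q / 2) → ℝ) (w : ℝ → ℝ) : Vh T k :=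
  let y₁ := (List.ofFn θ).foldr (fun t v => Dinv (1 - t) v) (proj0 T k (iteratedDeriv q w))
  let y₂ := if Even q then y₁ else Dinv θ₀ y₁
  (List.ofFn θ).foldl (fun v t => Dinv t v) y₂ + const ((∫ x in a..b, w x) / (b - a))

/-- The `L²(Ω)` norm `‖w - v_h‖`. -/
def l2Error (w : ℝ → ℝ) (v : Vh T k) : ℝ :=
  √(∑ j, ∫ x in (T.left j)..(T.right j), (w x - (v.poly j).eval x) ^ 2)

end Vh

/-! ### The continuous problem -/

/-- The Sobolev norm `‖w‖_m` on `Ω = [a, b]` (of a function of class `C^m`). -/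
def sobolevNorm (a b : ℝ) (m : ℕ) (w : ℝ → ℝ) : ℝ :=
  √(∑ i ∈ Finset.range (m + 1), ∫ x in a..b, (iteratedDeriv i w x) ^ 2)

/-- The differential operator `L = β ∂ₓ^q`. -/
def Lop (β : ℝ) (q : ℕ) (w : ℝ → ℝ) : ℝ → ℝ := fun x => β * iteratedDeriv q w x

/-- `u = u(t, x)` is a solution of `∂ₜ u = β ∂ₓ^q u` for `t ∈ [0, t_end]`, `(b - a)`-periodic and of
class `C^m` in `x`, and with `∂ₜ^i u = L^i u` for `1 ≤ i ≤ p + 1` (for `i = 1` this is the equation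
itself). -/
structure IsSmoothSolution (a b β : ℝ) (q p m : ℕ) (tEnd : ℝ) (u : ℝ → ℝ → ℝ) : Prop where
  periodic : ∀ t ∈ Icc 0 tEnd, Function.Periodic (u t) (b - a)
  contDiff : ∀ t ∈ Icc 0 tEnd, ContDiff ℝ m (u t)
  time_deriv : ∀ i ≤ p, ∀ t ∈ Icc 0 tEnd, ∀ x : ℝ,
    HasDerivWithinAt (fun r => (Lop β q)^[i] (u r) x) ((Lop β q)^[i + 1] (u t) x) (Icc 0 tEnd) t

/-- The function `σ(μ, t) = (e^{μt} - 1)/μ` for `μ > 0`, and `σ(0, t) = t`. -/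
def sigma (μ t : ℝ) : ℝ := if μ = 0 then t else (Real.exp (μ * t) - 1) / μ

end LDG

end

noncomputable section

namespace LDG

/-! ### Polynomials on a cell -/

/-! The scheme is compared with Π (`proj`), because Π inverts, factor by factor, the product that
makes up L_h. Hence L_h Π w = Π₀ L w holds exactly (`Lh_proj`), and the space discretization enters
only through the difference Π - Π₀.

One step: put x_i = Π L^i u and y_i = Π₀ L^i u. Then L_h x_i = y_{i+1}, and y_i - x_i is O(h^{k+1}).
As τ L_h does not increase norms, R_s(τ L_h) Π u differs from the sum of τ^i/i! Π L^i u over i ≤ p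
by O(τ h^{k+1} + τ^{p+1}) (`norm_rungeKutta_sub_taylor_le`). That sum differs from Π u(t+τ) by Π
applied to a Taylor remainder. Π is controlled by the maximum norms of a function and of its q-th
derivative (`exists_proj_sub_sum_norm_le`), so this difference is O(τ^{p+1}), provided the q-th
space derivative of u also has a Taylor expansion in time
(`IsSmoothSolution.abs_iteratedDeriv_sub_taylor_le`). Stability and a discrete Gronwall inequality
(`le_sigma_mul`) add up the steps, starting from the initial error zero.

The bound for Π - Π₀ (`exists_proj_error`) is obtained one factor at a time (`exists_Dinv_error`).
The generalized Gauss-Radau projection P of w satisfies D_{h,θ} P = Π₀ w' exactly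
(`IsGaussRadau.D_eq`) and is O(h^{k+1}) close to Π₀ w (`exists_isGaussRadau`). The discrete Poincaré
inequality (`exists_poincare`) turns closeness of the images under D_{h,θ} into closeness in V_h;
its proof is by duality and uses the Gauss-Radau projection for 1 - θ. The projections are estimated
in the maximum norm on cells, where the constants depend neither on the number of cells nor on their
lengths. -/

lemma integral_cell_eq (f : ℝ → ℝ) {l r : ℝ} (hlr : l < r) :
    ∫ x in l..r, f x = (r - l) * ∫ y in (0 : ℝ)..1, f (r - (r - l) * y) := by
  have hne : r - l ≠ 0 := (sub_pos.mpr hlr).ne'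
  rw [intervalIntegral.integral_comp_sub_mul _ hne]
  simp [hne]

lemma degree_derivative_lt_of_degree_lt {Q : ℝ[X]} {n : ℕ}
    (hQ : Q.degree < ((n + 1 : ℕ) : WithBot ℕ)) : Q.derivative.degree < n := by
  rcases eq_or_ne Q 0 with rfl | h0
  · simp
  rcases eq_or_ne Q.derivative 0 with h1 | h1
  · simp [h1]
  have := Polynomial.degree_derivative_lt h0
  rw [Polynomial.degree_eq_natDegree h1, Polynomial.degree_eq_natDegree h0] at this
  rw [Polynomial.degree_eq_natDegree h0] at hQ
  rw [Polynomial.degree_eq_natDegree h1]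
  norm_cast at *
  omega

/-- Repeated integration by parts against a polynomial of low degree. -/
lemma integral_iterate_derivative_mul_eq_zero {l r : ℝ} (n : ℕ) :
    ∀ G Q : ℝ[X], (∀ i < n, (Polynomial.derivative^[i] G).eval l = 0) →
      (∀ i < n, (Polynomial.derivative^[i] G).eval r = 0) → Q.degree < n →
      ∫ x in l..r, (Polynomial.derivative^[n] G).eval x * Q.eval x = 0 := by
  induction n with
  | zero =>
    intro G Q _ _ hQ
    have : Q = 0 := Polynomial.degree_eq_bot.mp (by simpa using hQ)
    simp [this]
  | succ n ih =>
    intro G Q hl hr hQ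
    have hQ' : Q.derivative.degree < n := degree_derivative_lt_of_degree_lt hQ
    have key := intervalIntegral.integral_deriv_mul_eq_sub
      (a := l) (b := r) (u := fun x => (Polynomial.derivative^[n] G).eval x)
      (u' := fun x => (Polynomial.derivative^[n+1] G).eval x)
      (v := fun x => Q.eval x) (v' := fun x => Q.derivative.eval x)
      (fun x _ => by
        rw [Function.iterate_succ_apply']
        exact Polynomial.hasDerivAt _ x)
      (fun x _ => Polynomial.hasDerivAt _ x)
      (Continuous.intervalIntegrable (by fun_prop) _ _)
      (Continuous.intervalIntegrable (by fun_prop) _ _)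
    rw [intervalIntegral.integral_add
      (Continuous.intervalIntegrable (by fun_prop) _ _)
      (Continuous.intervalIntegrable (by fun_prop) _ _),
      ih G _ (fun i hi => hl i (by omega)) (fun i hi => hr i (by omega)) hQ',
      hl n (by omega), hr n (by omega)] at key
    simpa using key

/-! ### Legendre polynomials on the reference cell and on a general cell. -/

/-- The shifted Legendre polynomial with real coefficients. -/
def legendreUnit (k : ℕ) : ℝ[X] := (Polynomial.shiftedLegendre k).map (Int.castRingHom ℝ)

lemma eval_legendreUnit_zero (k : ℕ) : (legendreUnit k).eval 0 = 1 := by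
  rw [← Polynomial.coeff_zero_eq_eval_zero, legendreUnit, Polynomial.coeff_map,
    Polynomial.coeff_shiftedLegendre]
  simp

lemma eval_legendreUnit_one (k : ℕ) : (legendreUnit k).eval 1 = (-1) ^ k := by
  have h := Polynomial.shiftedLegendre_eval_symm k (1 : ℝ)
  have e : ∀ x : ℝ,
      Polynomial.aeval x (Polynomial.shiftedLegendre k) = (legendreUnit k).eval x := by
    intro x
    rw [legendreUnit, Polynomial.eval_map, Polynomial.aeval_def]
    rfl
  rw [e, e, sub_self, eval_legendreUnit_zero, mul_one] at h
  exact h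

lemma degree_legendreUnit_lt (k : ℕ) : (legendreUnit k).degree < ((k + 1 : ℕ) : WithBot ℕ) := by
  refine lt_of_le_of_lt Polynomial.degree_map_le ?_
  rw [Polynomial.degree_shiftedLegendre]
  exact_mod_cast Nat.lt_succ_self k

lemma eval_iterate_derivative_eq_zero_of_dvd {G : ℝ[X]} {c : ℝ} {n i : ℕ}
    (h : (Polynomial.X - Polynomial.C c) ^ n ∣ G) (hi : i < n) :
    (Polynomial.derivative^[i] G).eval c = 0 := by
  have h1 : (Polynomial.X - Polynomial.C c) ^ (n - i) ∣ Polynomial.derivative^[i] G :=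
    Polynomial.pow_sub_dvd_iterate_derivative_of_pow_dvd i h
  have h2 : (Polynomial.X - Polynomial.C c) ∣ Polynomial.derivative^[i] G :=
    (dvd_pow_self _ (by omega)).trans h1
  exact Polynomial.dvd_iff_isRoot.mp h2

/-- Rodrigues' formula: up to the factor k!, the polynomial is the k-th derivative of X^k (1 - X)^k.
This vanishes to order k at both end points, so k integrations by parts leave no boundary terms and
differentiate Q to zero. -/
lemma integral_legendreUnit_mul (k : ℕ) {Q : ℝ[X]} (hQ : Q.degree < k) :
    ∫ x in (0 : ℝ)..1, (legendreUnit k).eval x * Q.eval x = 0 := by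
  set G : ℝ[X] := Polynomial.X ^ k * (1 - Polynomial.X) ^ k with hG
  have hR : (k.factorial : ℝ[X]) * legendreUnit k = Polynomial.derivative^[k] G := by
    have := congrArg (Polynomial.map (Int.castRingHom ℝ))
      (Polynomial.factorial_mul_shiftedLegendre_eq k)
    rw [Polynomial.map_mul, ← Polynomial.iterate_derivative_map] at this
    simpa [hG, legendreUnit] using this
  have h0 := integral_iterate_derivative_mul_eq_zero (l := 0) (r := 1) k G Q
    (fun i hi => eval_iterate_derivative_eq_zero_of_dvd (n := k) ⟨(1 - Polynomial.X) ^ k, by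
      simp [hG]⟩ hi)
    (fun i hi => eval_iterate_derivative_eq_zero_of_dvd (n := k)
      ⟨(-1) ^ k * Polynomial.X ^ k, by
        rw [hG, show (1 - Polynomial.X : ℝ[X]) = (-1) * (Polynomial.X - Polynomial.C 1) by
          simp, mul_pow]
        ring⟩ hi) hQ
  rw [← hR] at h0
  simp only [Polynomial.eval_mul, Polynomial.eval_natCast, mul_assoc,
    intervalIntegral.integral_const_mul] at h0
  exact (mul_eq_zero.mp h0).resolve_left (by exact_mod_cast k.factorial_ne_zero)

/-- The Legendre polynomial of degree `k` of the cell `[l, r]`, with value `1` at `r`. -/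
def legendreCell (k : ℕ) (l r : ℝ) : ℝ[X] :=
  -- The parametrization runs backwards, r ↦ 0 and l ↦ 1, since the shifted Legendre polynomial
  -- takes the value 1 at 0.
  (legendreUnit k).comp (Polynomial.C (r / (r - l)) - Polynomial.C (1 / (r - l)) * Polynomial.X)

lemma eval_legendreCell (k : ℕ) (l r x : ℝ) :
    (legendreCell k l r).eval x = (legendreUnit k).eval ((r - x) / (r - l)) := by
  simp only [legendreCell, Polynomial.eval_comp, Polynomial.eval_sub, Polynomial.eval_C,
    Polynomial.eval_mul, Polynomial.eval_X]
  congr 1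
  ring

lemma eval_legendreCell_right (k : ℕ) (l r : ℝ) : (legendreCell k l r).eval r = 1 := by
  simp [eval_legendreCell, eval_legendreUnit_zero]

lemma eval_legendreCell_left (k : ℕ) {l r : ℝ} (hlr : l < r) :
    (legendreCell k l r).eval l = (-1) ^ k := by
  rw [eval_legendreCell, div_self (sub_pos.mpr hlr).ne', eval_legendreUnit_one]

lemma degree_comp_affine_lt {p : ℝ[X]} {n : ℕ} (hp : p.degree < n) (c d : ℝ) :
    (p.comp (Polynomial.C c - Polynomial.C d * Polynomial.X)).degree < n := by
  rcases eq_or_ne p 0 with rfl | h0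
  · simp
  have h1 : p.natDegree < n := by
    rw [Polynomial.degree_eq_natDegree h0] at hp
    exact_mod_cast hp
  have h2 : (Polynomial.C c - Polynomial.C d * Polynomial.X).natDegree ≤ 1 := by
    refine (Polynomial.natDegree_sub_le _ _).trans (max_le (by simp) ?_)
    exact (Polynomial.natDegree_C_mul_le _ _).trans Polynomial.natDegree_X_le
  have h3 : (p.comp (Polynomial.C c - Polynomial.C d * Polynomial.X)).natDegree < n := by
    refine lt_of_le_of_lt Polynomial.natDegree_comp_le (lt_of_le_of_lt ?_ h1)
    nlinarith
  exact lt_of_le_of_lt Polynomial.degree_le_natDegree (by exact_mod_cast h3)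

lemma degree_legendreCell_lt (k : ℕ) (l r : ℝ) :
    (legendreCell k l r).degree < ((k + 1 : ℕ) : WithBot ℕ) :=
  degree_comp_affine_lt (degree_legendreUnit_lt k) _ _

lemma integral_legendreCell_mul (k : ℕ) {l r : ℝ} (hlr : l < r) {Q : ℝ[X]} (hQ : Q.degree < k) :
    ∫ x in l..r, (legendreCell k l r).eval x * Q.eval x = 0 := by
  have hne : r - l ≠ 0 := (sub_pos.mpr hlr).ne'
  rw [integral_cell_eq _ hlr]
  have h := integral_legendreUnit_mul k (degree_comp_affine_lt hQ r (r - l))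
  simp only [Polynomial.eval_comp, Polynomial.eval_sub, Polynomial.eval_C,
    Polynomial.eval_mul, Polynomial.eval_X] at h
  simp [eval_legendreCell, hne, h]

lemma exists_legendreCell_bound (k : ℕ) : ∃ B : ℝ, 0 < B ∧ ∀ l r : ℝ, l < r → ∀ x ∈ Icc l r,
    |(legendreCell k l r).eval x| ≤ B := by
  obtain ⟨B, hB⟩ := (isCompact_Icc (a := (0 : ℝ)) (b := 1)).exists_bound_of_continuousOn
    (f := fun x => (legendreUnit k).eval x) (Continuous.continuousOn (by fun_prop))
  refine ⟨max B 1, by positivity, fun l r hlr x hx => ?_⟩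
  rw [eval_legendreCell]
  have hpos := sub_pos.mpr hlr
  refine (hB _ ⟨div_nonneg (by linarith [hx.2]) hpos.le, ?_⟩).trans (le_max_left _ _)
  rw [div_le_one hpos]
  linarith [hx.1]

/-! ### Inverse inequalities and Taylor approximation on a cell. -/

/-- The mesh of `[0, 1]` with a single cell. -/
def unitMesh : Mesh 0 1 where
  N := 1
  N_pos := one_pos
  x := ![0, 1]
  strictMono := by
    rw [Fin.strictMono_iff_lt_succ]
    intro i
    fin_cases i
    simp
  x_first := rfl
  x_last := rfl

/-- Inverse inequality on the reference cell. -/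
lemma exists_inverse_unit (k : ℕ) : ∃ B : ℝ, 0 < B ∧ ∀ p : ℝ[X],
    p.degree < ((k + 1 : ℕ) : WithBot ℕ) →
    ∀ x ∈ Icc (0 : ℝ) 1, p.eval x ^ 2 ≤ B * ∫ y in (0 : ℝ)..1, p.eval y ^ 2 := by
  -- On the one-cell mesh, `Vh` is the space of polynomials with the L² norm of [0, 1]. The
  -- coefficient map is bounded because this space has finite dimension, and the coefficients
  -- control the values on [0, 1].
  let Φ : Vh unitMesh k →ₗ[ℝ] (Fin (k + 1) → ℝ) :=
    { toFun := fun v i => (v.poly 0).coeff i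
      map_add' := fun v w => by ext i; simp
      map_smul' := fun c v => by ext i; simp }
  set A := ‖LinearMap.toContinuousLinearMap Φ‖ with hA
  refine ⟨((k + 1) * A) ^ 2 + 1, by positivity, fun p hp x hx => ?_⟩
  let v : Vh unitMesh k := fun _ => ⟨p, Polynomial.mem_degreeLT.mpr hp⟩
  have hv : v.poly 0 = p := rfl
  have hnorm : ‖v‖ ^ 2 = ∫ y in (0 : ℝ)..1, p.eval y ^ 2 := by
    rw [← real_inner_self_eq_norm_sq, Vh.inner_def]
    change ∑ j : Fin 1, _ = _
    rw [Fin.sum_univ_one]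
    simp only [sq]
    rfl
  have h1 : ‖Φ v‖ ≤ A * ‖v‖ := (LinearMap.toContinuousLinearMap Φ).le_opNorm v
  have h2 : |p.eval x| ≤ (k + 1) * ‖Φ v‖ := by
    have hdeg : p.natDegree < k + 1 := by
      rcases eq_or_ne p 0 with rfl | h0
      · simp
      · rw [Polynomial.degree_eq_natDegree h0] at hp
        exact_mod_cast hp
    rw [Polynomial.eval_eq_sum_range' hdeg]
    refine (Finset.abs_sum_le_sum_abs _ _).trans ?_
    calc ∑ i ∈ Finset.range (k + 1), |p.coeff i * x ^ i|
        ≤ ∑ i ∈ Finset.range (k + 1), ‖Φ v‖ := by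
          refine Finset.sum_le_sum fun i hi => ?_
          rw [abs_mul, abs_pow, abs_of_nonneg hx.1]
          have := norm_le_pi_norm (Φ v) ⟨i, Finset.mem_range.mp hi⟩
          calc |p.coeff i| * x ^ i ≤ |p.coeff i| * 1 :=
                mul_le_mul_of_nonneg_left (pow_le_one₀ hx.1 hx.2) (abs_nonneg _)
            _ ≤ _ := by simpa [Φ, hv] using this
      _ = _ := by simp
  have h3 : |p.eval x| ≤ (k + 1) * A * ‖v‖ := by
    calc |p.eval x| ≤ (k + 1) * ‖Φ v‖ := h2
      _ ≤ (k + 1) * (A * ‖v‖) := by gcongr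
      _ = _ := by ring
  rw [← hnorm]
  calc p.eval x ^ 2 = |p.eval x| ^ 2 := (sq_abs _).symm
    _ ≤ ((k + 1) * A * ‖v‖) ^ 2 := by gcongr
    _ ≤ _ := by nlinarith [sq_nonneg ‖v‖]

/-- Inverse inequality on a cell. -/
lemma exists_inverse_cell (k : ℕ) : ∃ B : ℝ, 0 < B ∧ ∀ l r : ℝ, l < r → ∀ p : ℝ[X],
    p.degree < ((k + 1 : ℕ) : WithBot ℕ) → ∀ x ∈ Icc l r,
      (r - l) * p.eval x ^ 2 ≤ B * ∫ y in l..r, p.eval y ^ 2 := by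
  obtain ⟨B, hB, h⟩ := exists_inverse_unit k
  refine ⟨B, hB, fun l r hlr p hp x hx => ?_⟩
  have hpos := sub_pos.mpr hlr
  have := h _ (degree_comp_affine_lt hp r (r - l)) ((r - x) / (r - l))
    ⟨div_nonneg (by linarith [hx.2]) hpos.le, by rw [div_le_one hpos]; linarith [hx.1]⟩
  simp only [Polynomial.eval_comp, Polynomial.eval_sub, Polynomial.eval_C,
    Polynomial.eval_mul, Polynomial.eval_X] at this
  rw [mul_div_cancel₀ _ hpos.ne', sub_sub_cancel] at this
  rw [integral_cell_eq _ hlr]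
  calc (r - l) * p.eval x ^ 2 ≤ (r - l) * (B * _) := mul_le_mul_of_nonneg_left this hpos.le
    _ = _ := by ring

/-- Approximation of a smooth function on a cell by its Taylor polynomial. -/
lemma exists_taylor_cell {f : ℝ → ℝ} {k : ℕ} (hf : ContDiff ℝ (k + 1 : ℕ) f) {W l r : ℝ}
    (hlr : l < r) (hW : ∀ x, |iteratedDeriv (k + 1) f x| ≤ W) :
    ∃ p : ℝ[X], p.degree < ((k + 1 : ℕ) : WithBot ℕ) ∧
      ∀ x ∈ Icc l r, |f x - p.eval x| ≤ W * (r - l) ^ (k + 1) := by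
  have hW0 : 0 ≤ W := (abs_nonneg _).trans (hW 0)
  refine ⟨∑ i ∈ Finset.range (k + 1), Polynomial.C (((i.factorial : ℝ))⁻¹ *
    iteratedDerivWithin i f (Icc l r) l) * (Polynomial.X - Polynomial.C l) ^ i, ?_, ?_⟩
  · rw [← Polynomial.mem_degreeLT]
    refine Submodule.sum_mem _ fun i hi => ?_
    rw [Polynomial.C_mul']
    refine Submodule.smul_mem _ _ ?_
    rw [Polynomial.mem_degreeLT, Polynomial.degree_pow, Polynomial.degree_X_sub_C]
    have := Finset.mem_range.mp hi
    simp only [nsmul_eq_mul, mul_one]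
    exact_mod_cast this
  · intro x hx
    have hbd := taylor_mean_remainder_bound (f := f) (a := l) (b := r) (C := W) (x := x) (n := k)
      hlr.le (by exact_mod_cast hf.contDiffOn) hx (fun y hy => by
        rw [iteratedDerivWithin_eq_iteratedDeriv (uniqueDiffOn_Icc hlr) hf.contDiffAt hy]
        exact hW y)
    rw [taylor_within_apply] at hbd
    have e : ∀ i, ((i.factorial : ℝ)⁻¹ * (x - l) ^ i) • iteratedDerivWithin i f (Icc l r) l =
        ((i.factorial : ℝ)⁻¹ * iteratedDerivWithin i f (Icc l r) l) * (x - l) ^ i := by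
      intro i; rw [smul_eq_mul]; ring
    simp only [e] at hbd
    rw [Polynomial.eval_finsetSum]
    simp only [Polynomial.eval_mul, Polynomial.eval_C, Polynomial.eval_pow, Polynomial.eval_sub,
      Polynomial.eval_X]
    refine hbd.trans ?_
    have h1 : (1 : ℝ) ≤ k.factorial := by exact_mod_cast k.factorial_pos
    calc W * (x - l) ^ (k + 1) / k.factorial ≤ W * (x - l) ^ (k + 1) :=
          div_le_self (mul_nonneg hW0 (pow_nonneg (by linarith [hx.1]) _)) h1
      _ ≤ W * (r - l) ^ (k + 1) := by
          have := hx.1; have := hx.2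
          gcongr

/-! ### The `L²` projection of piecewise continuous functions -/

/-- A polynomial with the moments of a bounded function is bounded. -/
lemma exists_moment_stability (k : ℕ) : ∃ S : ℝ, 1 ≤ S ∧ ∀ l r : ℝ, l < r → ∀ P : ℝ[X],
    P.degree < ((k + 1 : ℕ) : WithBot ℕ) → ∀ f : ℝ → ℝ, Continuous f →
    (∫ x in l..r, P.eval x * P.eval x = ∫ x in l..r, f x * P.eval x) →
    ∀ W : ℝ, (∀ x ∈ Icc l r, |f x| ≤ W) → ∀ x ∈ Icc l r, |P.eval x| ≤ S * W := by
  obtain ⟨B, hB, h⟩ := exists_inverse_cell k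
  refine ⟨1 + √B, by linarith [Real.sqrt_nonneg B], fun l r hlr P hP f hf hm W hW x hx => ?_⟩
  have hpos := sub_pos.mpr hlr
  have hW0 : 0 ≤ W := (abs_nonneg _).trans (hW x hx)
  -- By Young's inequality f P ≤ (W² + P²)/2; half of ∫ P² is absorbed on the left, and the inverse
  -- inequality turns the L² bound into a pointwise one.
  have h1 : ∫ x in l..r, f x * P.eval x ≤ ∫ x in l..r, (W ^ 2 + P.eval x * P.eval x) / 2 := by
    refine intervalIntegral.integral_mono_on hlr.le
      (Continuous.intervalIntegrable (by fun_prop) _ _)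
      (Continuous.intervalIntegrable (by fun_prop) _ _) fun y hy => ?_
    have : f y ^ 2 ≤ W ^ 2 := sq_le_sq' (abs_le.mp (hW y hy)).1 (abs_le.mp (hW y hy)).2
    nlinarith [sq_nonneg (f y - P.eval y)]
  rw [intervalIntegral.integral_div, intervalIntegral.integral_add
    (Continuous.intervalIntegrable (by fun_prop) _ _)
    (Continuous.intervalIntegrable (by fun_prop) _ _), intervalIntegral.integral_const,
    smul_eq_mul, ← hm] at h1
  have h2 : ∫ x in l..r, P.eval x ^ 2 ≤ (r - l) * W ^ 2 := by
    simp only [sq (P.eval _)]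
    linarith
  have h3 := h l r hlr P hP x hx
  have h4 : (r - l) * P.eval x ^ 2 ≤ (r - l) * (B * W ^ 2) := by
    calc _ ≤ B * ∫ y in l..r, P.eval y ^ 2 := h3
      _ ≤ B * ((r - l) * W ^ 2) := by gcongr
      _ = _ := by ring
  have h5 : P.eval x ^ 2 ≤ (√B * W) ^ 2 := by
    rw [mul_pow, Real.sq_sqrt hB.le]
    exact le_of_mul_le_mul_left h4 hpos
  have h6 := abs_le_of_sq_le_sq h5 (by positivity)
  linarith

lemma Mesh.cell_le_h {a b : ℝ} (T : Mesh a b) (j : Fin T.N) : T.right j - T.left j ≤ T.h :=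
  le_ciSup (f := fun j => T.right j - T.left j) (Set.finite_range _).bddAbove j

lemma Mesh.h_pos {a b : ℝ} (T : Mesh a b) : 0 < T.h :=
  (sub_pos.mpr (T.left_lt_right 0)).trans_le (T.cell_le_h 0)

namespace Vh

variable {a b : ℝ} {T : Mesh a b} {k : ℕ}

lemma poly_degree_lt (v : Vh T k) (j : Fin T.N) :
    (v.poly j).degree < ((k + 1 : ℕ) : WithBot ℕ) :=
  Polynomial.mem_degreeLT.mp (v j).2

@[simp] lemma poly_sub (v w : Vh T k) (j : Fin T.N) : (v - w).poly j = v.poly j - w.poly j := rfl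

/-- The pairing of a piecewise defined function with an element of `V_h`. -/
def brokenPairing (w : Fin T.N → ℝ → ℝ) (v : Vh T k) : ℝ :=
  ∑ j, ∫ x in (T.left j)..(T.right j), w j x * (v.poly j).eval x

/-- The `L²` projection onto `V_h` of a piecewise defined function. -/
def brokenProj (k : ℕ) (w : Fin T.N → ℝ → ℝ) : Vh T k :=
  ∑ i, brokenPairing w (stdOrthonormalBasis ℝ (Vh T k) i) • stdOrthonormalBasis ℝ (Vh T k) i

lemma proj0_eq_brokenProj (w : ℝ → ℝ) : proj0 T k w = brokenProj k (fun _ => w) := rfl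

lemma inner_brokenProj {w : Fin T.N → ℝ → ℝ} (hw : ∀ j, Continuous (w j)) (v : Vh T k) :
    ⟪brokenProj k w, v⟫_ℝ = brokenPairing w v := by
  let ℓ : Vh T k →ₗ[ℝ] ℝ :=
    { toFun := brokenPairing w
      map_add' := fun v v' => by
        rw [brokenPairing, brokenPairing, brokenPairing, ← Finset.sum_add_distrib]
        refine Finset.sum_congr rfl fun j _ => ?_
        have := hw j
        rw [← intervalIntegral.integral_add]
        · simp [mul_add]
        · exact Continuous.intervalIntegrable (by fun_prop) _ _
        · exact Continuous.intervalIntegrable (by fun_prop) _ _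
      map_smul' := fun c v => by
        rw [brokenPairing, brokenPairing, RingHom.id_apply, smul_eq_mul, Finset.mul_sum]
        refine Finset.sum_congr rfl fun j _ => ?_
        rw [← intervalIntegral.integral_const_mul]
        simp [mul_left_comm] }
  have h1 : ℓ v = ℓ (∑ i, ⟪stdOrthonormalBasis ℝ (Vh T k) i, v⟫_ℝ •
      stdOrthonormalBasis ℝ (Vh T k) i) := by
    rw [OrthonormalBasis.sum_repr']
  change _ = ℓ v
  rw [h1, map_sum, brokenProj, sum_inner]
  refine Finset.sum_congr rfl fun i _ => ?_
  rw [map_smul, real_inner_smul_left, smul_eq_mul, mul_comm]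
  rfl

/-- The element of `V_h` that is equal to `p` on the cell `I_j` and vanishes on the other cells. -/
def single (j : Fin T.N) (p : ℝ[X]) (hp : p.degree < ((k + 1 : ℕ) : WithBot ℕ)) : Vh T k :=
  fun i => if i = j then ⟨p, Polynomial.mem_degreeLT.mpr hp⟩ else 0

lemma poly_single (j i : Fin T.N) (p : ℝ[X]) (hp : p.degree < ((k + 1 : ℕ) : WithBot ℕ)) :
    (single j p hp : Vh T k).poly i = if i = j then p else 0 := by
  simp only [poly, single]
  split_ifs <;> rfl

lemma brokenPairing_single (w : Fin T.N → ℝ → ℝ) (j : Fin T.N) (p : ℝ[X])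
    (hp : p.degree < ((k + 1 : ℕ) : WithBot ℕ)) :
    brokenPairing w (single j p hp : Vh T k) =
      ∫ x in (T.left j)..(T.right j), w j x * p.eval x := by
  rw [brokenPairing, Finset.sum_eq_single j]
  · simp [poly_single]
  · intro i _ hij
    simp [poly_single, hij]
  · simp

/-- Test functions supported on one cell show that the projection acts cell by cell. This locality
is what gives estimates in the maximum norm. -/
lemma integral_brokenProj_mul {w : Fin T.N → ℝ → ℝ} (hw : ∀ j, Continuous (w j)) (j : Fin T.N)
    {p : ℝ[X]} (hp : p.degree < ((k + 1 : ℕ) : WithBot ℕ)) :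
    ∫ x in (T.left j)..(T.right j), ((brokenProj k w).poly j).eval x * p.eval x =
      ∫ x in (T.left j)..(T.right j), w j x * p.eval x := by
  have h := inner_brokenProj hw (single j p hp : Vh T k)
  have e : ⟪brokenProj k w, (single j p hp : Vh T k)⟫_ℝ =
    brokenPairing (fun i x => ((brokenProj k w).poly i).eval x) (single j p hp : Vh T k) := rfl
  rwa [e, brokenPairing_single, brokenPairing_single] at h

/-- The projection inherits the approximation properties of polynomials in the maximum norm. -/
lemma exists_brokenProj_bound (k : ℕ) : ∃ S : ℝ, 1 ≤ S ∧ ∀ (a b : ℝ) (T : Mesh a b)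
    (w : Fin T.N → ℝ → ℝ), (∀ j, Continuous (w j)) → ∀ (j : Fin T.N) (Q : ℝ[X]),
    Q.degree < ((k + 1 : ℕ) : WithBot ℕ) → ∀ W : ℝ,
    (∀ x ∈ Icc (T.left j) (T.right j), |w j x - Q.eval x| ≤ W) →
    ∀ x ∈ Icc (T.left j) (T.right j),
      |((brokenProj k w).poly j).eval x - Q.eval x| ≤ S * W := by
  obtain ⟨S, hS, h⟩ := exists_moment_stability k
  refine ⟨S, hS, fun a b T w hw j Q hQ W hW x hx => ?_⟩
  have hdeg : ((brokenProj k w).poly j - Q).degree < ((k + 1 : ℕ) : WithBot ℕ) :=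
    lt_of_le_of_lt (Polynomial.degree_sub_le _ _) (max_lt (poly_degree_lt _ j) hQ)
  have hwj := hw j
  -- The projection minus Q has the same moment against itself as w - Q, so moment stability applies
  -- to the pair.
  have := h _ _ (T.left_lt_right j) ((brokenProj k w).poly j - Q) hdeg
    (fun x => w j x - Q.eval x) (by fun_prop) ?_ W hW x hx
  · simpa using this
  have h1 := integral_brokenProj_mul hw j hdeg
  have e1 : ∀ x, ((brokenProj k w).poly j - Q).eval x * ((brokenProj k w).poly j - Q).eval x =
      ((brokenProj k w).poly j).eval x * ((brokenProj k w).poly j - Q).eval x -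
      Q.eval x * ((brokenProj k w).poly j - Q).eval x := by
    intro x; rw [Polynomial.eval_sub]; ring
  simp only [e1, sub_mul (w j _)]
  rw [intervalIntegral.integral_sub (Continuous.intervalIntegrable (by fun_prop) _ _)
    (Continuous.intervalIntegrable (by fun_prop) _ _), h1,
    intervalIntegral.integral_sub (Continuous.intervalIntegrable (by fun_prop) _ _)
    (Continuous.intervalIntegrable (by fun_prop) _ _)]

/-- Approximation error of the `L²` projection in the maximum norm. -/
lemma exists_proj0_error (k : ℕ) : ∃ C : ℝ, 0 ≤ C ∧ ∀ (a b : ℝ) (T : Mesh a b) (f : ℝ → ℝ) (W : ℝ),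
    ContDiff ℝ (k + 1 : ℕ) f → (∀ x, |iteratedDeriv (k + 1) f x| ≤ W) → ∀ j,
    ∀ x ∈ Icc (T.left j) (T.right j),
      |f x - ((proj0 T k f).poly j).eval x| ≤ C * (W * T.h ^ (k + 1)) := by
  obtain ⟨S, hS, h⟩ := exists_brokenProj_bound k
  refine ⟨1 + S, by linarith, fun a b T f W hf hW j x hx => ?_⟩
  have hW0 : 0 ≤ W := (abs_nonneg _).trans (hW 0)
  obtain ⟨Q, hQ, hfQ⟩ := exists_taylor_cell hf (T.left_lt_right j) hW
  have hle : W * (T.right j - T.left j) ^ (k + 1) ≤ W * T.h ^ (k + 1) := by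
    have := (sub_pos.mpr (T.left_lt_right j)).le
    have := T.cell_le_h j
    gcongr
  have h1 := h a b T (fun _ => f) (fun _ => hf.continuous) j Q hQ _
    (fun y hy => (hfQ y hy).trans hle) x hx
  rw [proj0_eq_brokenProj]
  calc |f x - ((brokenProj k fun _ => f).poly j).eval x|
      = |(f x - Q.eval x) - (((brokenProj k fun _ => f).poly j).eval x - Q.eval x)| := by
        congr 1; ring
    _ ≤ |f x - Q.eval x| + |((brokenProj k fun _ => f).poly j).eval x - Q.eval x| := abs_sub _ _
    _ ≤ W * T.h ^ (k + 1) + S * (W * T.h ^ (k + 1)) := add_le_add ((hfQ x hx).trans hle) h1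
    _ = _ := by ring

/-! ### The generalized Gauss-Radau projection -/

/-- The gap between the two moduli is the diagonal dominance of the cyclic system below; this is how
θ ≠ 1/2 enters. -/
lemma abs_ne_abs_one_sub {θ : ℝ} (hθ : θ ≠ 1 / 2) : |θ| ≠ |1 - θ| := by
  intro h
  rcases abs_eq_abs.mp h with h | h
  · exact hθ (by linarith)
  · linarith

/-- The cyclic two-point system behind the generalized Gauss-Radau projection. -/
lemma exists_cyclic_solution {N : ℕ} [NeZero N] {θ ε : ℝ} (hθ : θ ≠ 1 / 2) (hε : |ε| = 1)
    (r : Fin N → ℝ) : ∃ c : Fin N → ℝ, (∀ j, θ * c j + (1 - θ) * (ε * c (j + 1)) = r j) ∧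
      |(|θ| - |1 - θ|)| * ‖c‖ ≤ ‖r‖ := by
  let Φ : (Fin N → ℝ) →ₗ[ℝ] (Fin N → ℝ) :=
    { toFun := fun c j => θ * c j + (1 - θ) * (ε * c (j + 1))
      map_add' := fun c d => by ext j; simp; ring
      map_smul' := fun t c => by ext j; simp; ring }
  have hshift : ∀ c : Fin N → ℝ, ‖fun j => (1 - θ) * (ε * c (j + 1))‖ = |1 - θ| * ‖c‖ := by
    intro c
    have e1 : (fun j => (1 - θ) * (ε * c (j + 1))) = ((1 - θ) * ε) • fun j => c (j + 1) := by
      ext j; simp [mul_assoc]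
    rw [e1, norm_smul, norm_mul, Real.norm_eq_abs, Real.norm_eq_abs, hε, mul_one]
    congr 1
    refine le_antisymm ((pi_norm_le_iff_of_nonneg (norm_nonneg _)).mpr fun j => norm_le_pi_norm c _)
      ((pi_norm_le_iff_of_nonneg (norm_nonneg _)).mpr fun j => ?_)
    have := norm_le_pi_norm (fun j => c (j + 1)) (j - 1)
    simpa using this
  -- The cyclic shift preserves the maximum norm, so the term with the larger coefficient dominates
  -- the other one; the two triangle inequalities cover both cases. Injectivity, hence solvability
  -- in finite dimension, follows.
  have hbd : ∀ c, |(|θ| - |1 - θ|)| * ‖c‖ ≤ ‖Φ c‖ := by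
    intro c
    have e : Φ c = θ • c + fun j => (1 - θ) * (ε * c (j + 1)) := rfl
    have h1 : |θ| * ‖c‖ ≤ ‖Φ c‖ + |1 - θ| * ‖c‖ := by
      rw [← hshift, ← Real.norm_eq_abs, ← norm_smul]
      calc ‖θ • c‖ = ‖Φ c - fun j => (1 - θ) * (ε * c (j + 1))‖ := by rw [e, add_sub_cancel_right]
        _ ≤ _ := norm_sub_le _ _
    have h2 : |1 - θ| * ‖c‖ ≤ ‖Φ c‖ + |θ| * ‖c‖ := by
      rw [← hshift, ← Real.norm_eq_abs, ← norm_smul]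
      calc ‖fun j => (1 - θ) * (ε * c (j + 1))‖ = ‖Φ c - θ • c‖ := by rw [e, add_sub_cancel_left]
        _ ≤ _ := norm_sub_le _ _
    rcases abs_cases (|θ| - |1 - θ|) with ⟨h, _⟩ | ⟨h, _⟩ <;> rw [h] <;> linarith
  have hinj : Function.Injective Φ := by
    rw [injective_iff_map_eq_zero]
    intro c hc
    have := hbd c
    rw [hc, norm_zero] at this
    have hpos : 0 < |(|θ| - |1 - θ|)| := abs_pos.mpr (sub_ne_zero.mpr (abs_ne_abs_one_sub hθ))
    exact norm_le_zero_iff.mp (by nlinarith [norm_nonneg c])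
  obtain ⟨c, hc⟩ := (LinearMap.injective_iff_surjective.mp hinj) r
  exact ⟨c, fun j => congrFun hc j, hc ▸ hbd c⟩

/-- `P` is the generalized Gauss-Radau projection of the piecewise defined function `w`. -/
structure IsGaussRadau (θ : ℝ) (w : Fin T.N → ℝ → ℝ) (P : Vh T k) : Prop where
  moment : ∀ (j : Fin T.N) (p : ℝ[X]), p.degree < (k : WithBot ℕ) →
    ∫ x in (T.left j)..(T.right j), (P.poly j).eval x * p.eval x =
      ∫ x in (T.left j)..(T.right j), w j x * p.eval x
  flux_eq : ∀ j, P.flux θ j = w j (T.right j)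

/-- Correct the L² projection on each cell by a multiple c_j of the Legendre polynomial of degree k.
The moments against degree below k do not change, and the end values 1 and (-1)^k turn the flux
conditions into a cyclic system for c. Its right-hand side is a flux of the projection error, so the
correction is no larger than that error up to a constant. -/
lemma exists_isGaussRadau (k : ℕ) {θ : ℝ} (hθ : θ ≠ 1 / 2) : ∃ C : ℝ, 0 ≤ C ∧
    ∀ (a b : ℝ) (T : Mesh a b) (w : Fin T.N → ℝ → ℝ), (∀ j, Continuous (w j)) →
    (∀ j, w (j + 1) (T.left (j + 1)) = w j (T.right j)) → ∀ E : ℝ,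
    (∀ j, ∀ x ∈ Icc (T.left j) (T.right j), |w j x - ((brokenProj k w).poly j).eval x| ≤ E) →
    ∃ P : Vh T k, IsGaussRadau θ w P ∧ ∀ j, ∀ x ∈ Icc (T.left j) (T.right j),
      |(P.poly j).eval x - ((brokenProj k w).poly j).eval x| ≤ C * E := by
  obtain ⟨B, hB, hΛ⟩ := exists_legendreCell_bound k
  set δ := |(|θ| - |1 - θ|)| with hδ
  have hδpos : 0 < δ := abs_pos.mpr (sub_ne_zero.mpr (abs_ne_abs_one_sub hθ))
  refine ⟨(|θ| + |1 - θ|) / δ * B, by positivity, fun a b T w hw hmatch E hE => ?_⟩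
  have hE0 : 0 ≤ E := (abs_nonneg _).trans (hE 0 _ (left_mem_Icc.mpr (T.left_lt_right 0).le))
  set π := brokenProj k w with hπ
  let r : Fin T.N → ℝ := fun j => w j (T.right j) - π.flux θ j
  obtain ⟨c, hc, hcr⟩ := exists_cyclic_solution (ε := (-1) ^ k) hθ (by simp) r
  have hr : ‖r‖ ≤ (|θ| + |1 - θ|) * E := by
    refine (pi_norm_le_iff_of_nonneg (by positivity)).mpr fun j => ?_
    -- As w is continuous across the interface, it equals its own numerical flux, and r is the flux
    -- of the projection error.
    have e : r j = θ * (w j (T.right j) - (π.poly j).eval (T.right j)) + (1 - θ) *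
        (w (j + 1) (T.left (j + 1)) - (π.poly (j + 1)).eval (T.left (j + 1))) := by
      simp only [r, flux, traceMinus, tracePlus, hmatch]
      ring
    rw [e, Real.norm_eq_abs]
    refine (abs_add_le _ _).trans ?_
    rw [abs_mul, abs_mul, add_mul]
    have h1 := hE j _ (right_mem_Icc.mpr (T.left_lt_right j).le)
    have h2 := hE (j + 1) _ (left_mem_Icc.mpr (T.left_lt_right (j + 1)).le)
    gcongr
  let Λ : Fin T.N → ℝ[X] := fun j => legendreCell k (T.left j) (T.right j)
  let P : Vh T k := fun j => π j + c j • ⟨Λ j, Polynomial.mem_degreeLT.mpr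
    (degree_legendreCell_lt k _ _)⟩
  have hP : ∀ j, P.poly j = π.poly j + c j • Λ j := fun j => rfl
  refine ⟨P, ⟨fun j p hp => ?_, fun j => ?_⟩, fun j x hx => ?_⟩
  · rw [← integral_brokenProj_mul hw j (hp.trans (by exact_mod_cast Nat.lt_succ_self k)), hP]
    have h0 := integral_legendreCell_mul k (T.left_lt_right j) hp
    have e : ∀ x, (π.poly j + c j • Λ j).eval x * p.eval x =
        (π.poly j).eval x * p.eval x + c j * ((Λ j).eval x * p.eval x) := by
      intro x; simp; ring
    simp only [e]
    rw [intervalIntegral.integral_add (Continuous.intervalIntegrable (by fun_prop) _ _)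
      (Continuous.intervalIntegrable (by fun_prop) _ _), intervalIntegral.integral_const_mul, h0]
    simp [hπ]
  · have h1 := hc j
    simp only [r, flux, traceMinus, tracePlus] at h1
    simp only [flux, traceMinus, tracePlus, hP, Polynomial.eval_add, Polynomial.eval_smul, Λ,
      eval_legendreCell_right, eval_legendreCell_left k (T.left_lt_right _), smul_eq_mul]
    linarith
  · rw [hP]
    have h1 : ‖c‖ ≤ (|θ| + |1 - θ|) * E / δ := by
      rw [le_div_iff₀ hδpos]
      linarith
    have h2 := hΛ _ _ (T.left_lt_right j) x hx
    have h3 := norm_le_pi_norm c j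
    simp only [Polynomial.eval_add, add_sub_cancel_left, Polynomial.eval_smul, smul_eq_mul, abs_mul]
    calc |c j| * |(Λ j).eval x| ≤ ((|θ| + |1 - θ|) * E / δ) * B := by
          refine mul_le_mul (h3.trans h1) h2 (abs_nonneg _) (by positivity)
      _ = _ := by ring

lemma sum_cyclic_shift {N : ℕ} [NeZero N] (f : Fin N → ℝ) : ∑ j, f (j + 1) = ∑ j, f j :=
  Equiv.sum_comp (Equiv.addRight (1 : Fin N)) f

/-- `D_{h,θ}` maps the Gauss-Radau projection of `w` to the `L²` projection of its
derivative. -/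
lemma IsGaussRadau.D_eq {θ : ℝ} {w g : Fin T.N → ℝ → ℝ} {P : Vh T k} (hP : IsGaussRadau θ w P)
    (hw : ∀ j x, HasDerivAt (w j) (g j x) x) (hg : ∀ j, Continuous (g j))
    (hmatch : ∀ j, w (j + 1) (T.left (j + 1)) = w j (T.right j)) :
    D T k θ P = brokenProj k g := by
  have hwc : ∀ j, Continuous (w j) := fun j =>
    continuous_iff_continuousAt.mpr fun x => (hw j x).continuousAt
  refine ext_inner_right ℝ fun v => ?_
  rw [inner_D, inner_brokenProj hg, dgForm, brokenPairing]
  -- The derivative of v has degree below k, so the moment condition replaces P by w, which is then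
  -- integrated by parts. The boundary terms cancel against the flux terms after a cyclic shift of
  -- the sum.
  have h1 : ∀ j, ∫ x in (T.left j)..(T.right j), (P.poly j).eval x * (v.poly j).derivative.eval x =
      w j (T.right j) * (v.poly j).eval (T.right j) - w j (T.left j) * (v.poly j).eval (T.left j)
      - ∫ x in (T.left j)..(T.right j), g j x * (v.poly j).eval x := by
    intro j
    rw [hP.moment j _ (degree_derivative_lt_of_degree_lt (poly_degree_lt v j))]
    exact intervalIntegral.integral_mul_deriv_eq_deriv_mul (fun x _ => hw j x)
      (fun x _ => (v.poly j).hasDerivAt x) ((hg j).intervalIntegrable _ _)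
      (Continuous.intervalIntegrable (by fun_prop) _ _)
  simp only [h1, hP.flux_eq, jump, tracePlus, traceMinus, mul_sub, Finset.sum_sub_distrib]
  have h2 := sum_cyclic_shift fun j => w j (T.left j) * (v.poly j).eval (T.left j)
  simp only [hmatch] at h2
  rw [h2]
  ring

end Vh

/-! ### Sums over the cells and the periodic interface. -/

lemma Mesh.sum_sub {a b : ℝ} (T : Mesh a b) (F : ℝ → ℝ) :
    ∑ j, (F (T.right j) - F (T.left j)) = F b - F a := by
  let G : ℕ → ℝ := fun n => if hn : n < T.N + 1 then F (T.x ⟨n, hn⟩) else 0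
  have h1 : ∀ j : Fin T.N, F (T.right j) - F (T.left j) = G (j + 1) - G j := by
    intro j
    have := j.2
    simp only [G, Mesh.right, Mesh.left]
    rw [dif_pos (by omega), dif_pos (by omega)]
    rfl
  simp only [h1]
  rw [Fin.sum_univ_eq_sum_range (fun n => G (n + 1) - G n), Finset.sum_range_sub]
  have hN : G T.N = F b := by
    simp only [G]
    rw [dif_pos (by omega)]
    exact congrArg F T.x_last
  have h0 : G 0 = F a := by
    simp only [G]
    rw [dif_pos (by omega)]
    exact congrArg F T.x_first
  rw [hN, h0]

lemma Mesh.sum_length {a b : ℝ} (T : Mesh a b) : ∑ j, (T.right j - T.left j) = b - a :=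
  T.sum_sub id

lemma Mesh.sum_integral {a b : ℝ} (T : Mesh a b) {f : ℝ → ℝ} (hf : Continuous f) :
    ∑ j, ∫ x in (T.left j)..(T.right j), f x = ∫ x in a..b, f x := by
  have := T.sum_sub fun y => ∫ x in a..y, f x
  rw [intervalIntegral.integral_same, sub_zero] at this
  rw [← this]
  refine Finset.sum_congr rfl fun j _ => ?_
  rw [intervalIntegral.integral_interval_sub_left] <;> exact hf.intervalIntegrable _ _

/-- The two points coincide, except at the wrap-around of `Fin T.N`, where they are a and b and the
hypothesis on f identifies the values. -/
lemma Mesh.left_succ_eq {a b : ℝ} (T : Mesh a b) {f : ℝ → ℝ} (hf : f a = f b) (j : Fin T.N) :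
    f (T.left (j + 1)) = f (T.right j) := by
  rcases Nat.lt_or_ge (j + 1) T.N with h | h
  · congr 1
    simp only [Mesh.left, Mesh.right]
    congr 1
    ext
    simp only [Fin.val_castSucc, Fin.val_succ]
    rw [Fin.val_add_one_of_lt' (by omega)]
  · have hj : (j : ℕ) + 1 = T.N := by omega
    have h1 : T.right j = b := by
      refine Eq.trans ?_ T.x_last
      simp only [Mesh.right]
      congr 1
      ext
      simpa using hj
    have h2 : T.left (j + 1) = a := by
      refine Eq.trans ?_ T.x_first
      simp only [Mesh.left]
      congr 1
      ext
      simp [Fin.val_add, hj]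
    rw [h1, h2, hf]

namespace Vh

variable {a b : ℝ} {T : Mesh a b} {k : ℕ}

/-! ### Norm estimates -/

lemma norm_sq_eq (v : Vh T k) :
    ‖v‖ ^ 2 = ∑ j, ∫ x in (T.left j)..(T.right j), (v.poly j).eval x ^ 2 := by
  rw [← real_inner_self_eq_norm_sq, inner_def]
  simp only [sq]

lemma sum_integral_le {f : Fin T.N → ℝ → ℝ} (hf : ∀ j, Continuous (f j)) {E : ℝ}
    (hE : ∀ j, ∀ x ∈ Icc (T.left j) (T.right j), f j x ≤ E) :
    ∑ j, ∫ x in (T.left j)..(T.right j), f j x ≤ (b - a) * E := by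
  rw [← T.sum_length, Finset.sum_mul]
  refine Finset.sum_le_sum fun j _ => ?_
  have h := intervalIntegral.integral_mono_on (μ := MeasureTheory.volume) (T.left_lt_right j).le
    ((hf j).intervalIntegrable _ _) (continuous_const.intervalIntegrable _ _) (hE j)
  simpa using h

lemma b_sub_a_pos (T : Mesh a b) : 0 < b - a := by
  rw [← T.sum_length]
  exact Finset.sum_pos (fun j _ => sub_pos.mpr (T.left_lt_right j)) ⟨0, Finset.mem_univ _⟩

lemma norm_le_of_abs_le (v : Vh T k) {E : ℝ}
    (hE : ∀ j, ∀ x ∈ Icc (T.left j) (T.right j), |(v.poly j).eval x| ≤ E) :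
    ‖v‖ ≤ √(b - a) * E := by
  have hE0 : 0 ≤ E := (abs_nonneg _).trans (hE 0 _ (left_mem_Icc.mpr (T.left_lt_right 0).le))
  refine abs_le_of_sq_le_sq' ?_ (by positivity) |>.2
  rw [norm_sq_eq, mul_pow, Real.sq_sqrt (b_sub_a_pos T).le]
  refine sum_integral_le (f := fun j x => (v.poly j).eval x ^ 2) (fun j => by fun_prop)
    fun j x hx => ?_
  exact sq_le_sq' (abs_le.mp (hE j x hx)).1 (abs_le.mp (hE j x hx)).2

/-- Since w need not lie in V_h, the triangle inequality of `Vh` does not apply. The pointwise bound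
(x + y)² ≤ 2x² + 2y² replaces it, at the price of the factor 2. -/
lemma l2Error_le {w : ℝ → ℝ} (hw : Continuous w) (v' v : Vh T k) {E : ℝ}
    (hE : ∀ j, ∀ x ∈ Icc (T.left j) (T.right j), |w x - (v'.poly j).eval x| ≤ E) :
    l2Error w v ≤ 2 * (√(b - a) * E + ‖v' - v‖) := by
  have hE0 : 0 ≤ E := (abs_nonneg _).trans (hE 0 _ (left_mem_Icc.mpr (T.left_lt_right 0).le))
  rw [l2Error]
  refine Real.sqrt_le_iff.mpr ⟨by positivity, ?_⟩
  have h1 : ∑ j, ∫ x in (T.left j)..(T.right j), (w x - (v.poly j).eval x) ^ 2 ≤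
      ∑ j, (2 * (∫ x in (T.left j)..(T.right j), (w x - (v'.poly j).eval x) ^ 2) +
        2 * ∫ x in (T.left j)..(T.right j), ((v' - v).poly j).eval x ^ 2) := by
    refine Finset.sum_le_sum fun j _ => ?_
    rw [← intervalIntegral.integral_const_mul, ← intervalIntegral.integral_const_mul,
      ← intervalIntegral.integral_add (Continuous.intervalIntegrable (by fun_prop) _ _)
        (Continuous.intervalIntegrable (by fun_prop) _ _)]
    refine intervalIntegral.integral_mono_on (T.left_lt_right j).le
      (Continuous.intervalIntegrable (by fun_prop) _ _)
      (Continuous.intervalIntegrable (by fun_prop) _ _) fun x _ => ?_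
    simp only [poly_sub, Polynomial.eval_sub]
    nlinarith [sq_nonneg ((w x - (v'.poly j).eval x) - ((v'.poly j).eval x - (v.poly j).eval x))]
  have h2 : ∑ j, ∫ x in (T.left j)..(T.right j), (w x - (v'.poly j).eval x) ^ 2 ≤
      (b - a) * E ^ 2 :=
    sum_integral_le (f := fun j x => (w x - (v'.poly j).eval x) ^ 2) (fun j => by fun_prop)
      fun j x hx => sq_le_sq' (abs_le.mp (hE j x hx)).1 (abs_le.mp (hE j x hx)).2
  rw [Finset.sum_add_distrib, ← Finset.mul_sum, ← Finset.mul_sum, ← norm_sq_eq] at h1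
  have h3 : (√(b - a) * E) ^ 2 = (b - a) * E ^ 2 := by
    rw [mul_pow, Real.sq_sqrt (b_sub_a_pos T).le]
  have h4 : 0 ≤ √(b - a) * E := by positivity
  nlinarith [norm_nonneg (v' - v), mul_nonneg h4 (norm_nonneg (v' - v))]

/-- Integrate ‖v‖ |v| ≤ ‖v‖² + v² and divide by ‖v‖. Using this in place of Cauchy-Schwarz accounts
for the constant. -/
lemma sum_integral_abs_le (v : Vh T k) :
    ∑ j, ∫ x in (T.left j)..(T.right j), |(v.poly j).eval x| ≤ (b - a + 1) * ‖v‖ := by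
  rcases (norm_nonneg v).eq_or_lt with h0 | hpos
  · have hv : v = 0 := norm_eq_zero.mp h0.symm
    simp [hv]
  have h1 : ‖v‖ * ∑ j, ∫ x in (T.left j)..(T.right j), |(v.poly j).eval x| ≤
      ∑ j, ((T.right j - T.left j) * ‖v‖ ^ 2 +
        ∫ x in (T.left j)..(T.right j), (v.poly j).eval x ^ 2) := by
    rw [Finset.mul_sum]
    refine Finset.sum_le_sum fun j _ => ?_
    have e : (T.right j - T.left j) * ‖v‖ ^ 2 = ∫ x in (T.left j)..(T.right j), ‖v‖ ^ 2 := by simp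
    rw [← intervalIntegral.integral_const_mul, e,
      ← intervalIntegral.integral_add (Continuous.intervalIntegrable (by fun_prop) _ _)
        (Continuous.intervalIntegrable (by fun_prop) _ _)]
    refine intervalIntegral.integral_mono_on (T.left_lt_right j).le
      (Continuous.intervalIntegrable (by fun_prop) _ _)
      (Continuous.intervalIntegrable (by fun_prop) _ _) fun x _ => ?_
    rw [← sq_abs ((v.poly j).eval x)]
    nlinarith [sq_nonneg (‖v‖ - |(v.poly j).eval x|), sq_nonneg ‖v‖,
      sq_nonneg |(v.poly j).eval x|]
  rw [Finset.sum_add_distrib, ← Finset.sum_mul, T.sum_length, ← norm_sq_eq] at h1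
  refine le_of_mul_le_mul_left (h1.trans_eq ?_) hpos
  ring

/-! ### Constants and mean values -/

@[simp] lemma poly_const (c : ℝ) (j : Fin T.N) : (const c : Vh T k).poly j = Polynomial.C c := rfl

lemma const_eq_smul (c : ℝ) : (const c : Vh T k) = c • const 1 :=
  ext_poly fun j => by
    rw [poly_smul, poly_const, poly_const, Polynomial.smul_C, smul_eq_mul, mul_one]

lemma inner_const_one (v : Vh T k) :
    ⟪v, const 1⟫_ℝ = ∑ j, ∫ x in (T.left j)..(T.right j), (v.poly j).eval x := by
  simp [inner_def]

lemma inner_const_const (c : ℝ) : ⟪(const c : Vh T k), const 1⟫_ℝ = c * (b - a) := by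
  rw [inner_const_one, ← T.sum_length, Finset.mul_sum]
  simp [mul_comm]

lemma inner_proj0_const {f : ℝ → ℝ} (hf : Continuous f) :
    ⟪proj0 T k f, const 1⟫_ℝ = ∫ x in a..b, f x := by
  rw [inner_proj0 hf, pairing, ← T.sum_integral hf]
  simp

/-- `Z_h` as a subspace. -/
def zeroMean (T : Mesh a b) (k : ℕ) : Submodule ℝ (Vh T k) where
  carrier := Zh T k
  add_mem' {v w} hv hw := by
    simp only [Zh, mem_ofPred_eq] at *
    rw [inner_add_left, hv, hw, add_zero]
  zero_mem' := by simp [Zh]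
  smul_mem' c v hv := by
    simp only [Zh, mem_ofPred_eq] at *
    rw [real_inner_smul_left, hv, mul_zero]

lemma mem_zeroMean {v : Vh T k} : v ∈ zeroMean T k ↔ ⟪v, const 1⟫_ℝ = 0 := Iff.rfl

/-- The part of `v` with zero mean. -/
def centered (v : Vh T k) : Vh T k := v - const (⟪v, const 1⟫_ℝ / (b - a))

lemma centered_mem (v : Vh T k) : centered v ∈ zeroMean T k := by
  rw [mem_zeroMean, centered, inner_sub_left, inner_const_const,
    div_mul_cancel₀ _ (b_sub_a_pos T).ne', sub_self]

lemma norm_centered_le (v : Vh T k) : ‖centered v‖ ≤ ‖v‖ := by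
  have h0 : ⟪centered v, const (⟪v, const 1⟫_ℝ / (b - a))⟫_ℝ = 0 := by
    rw [const_eq_smul, real_inner_smul_right, mem_zeroMean.mp (centered_mem v), mul_zero]
  have h := norm_add_sq_real (centered v) (const (⟪v, const 1⟫_ℝ / (b - a)))
  rw [h0, centered, sub_add_cancel] at h
  refine abs_le_of_sq_le_sq' ?_ (norm_nonneg _) |>.2
  rw [centered]
  nlinarith [sq_nonneg ‖(const (⟪v, const 1⟫_ℝ / (b - a)) : Vh T k)‖]

/-! ### The operators `D_{h,θ}` -/

/-- Integrate by parts on each cell. At an interface the discrete product rule applies: the θ-flux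
of w times [v] plus the (1-θ)-flux of v times [w] is the jump [wv]. -/
lemma dgForm_skew (θ : ℝ) (w v : Vh T k) : dgForm θ w v = -dgForm (1 - θ) v w := by
  have h1 : ∀ j, ∫ x in (T.left j)..(T.right j), (w.poly j).eval x * (v.poly j).derivative.eval x =
      (w.poly j).eval (T.right j) * (v.poly j).eval (T.right j) -
      (w.poly j).eval (T.left j) * (v.poly j).eval (T.left j) -
      ∫ x in (T.left j)..(T.right j), (v.poly j).eval x * (w.poly j).derivative.eval x := by
    intro j
    simp only [mul_comm ((v.poly j).eval _) ((w.poly j).derivative.eval _)]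
    exact intervalIntegral.integral_mul_deriv_eq_deriv_mul (fun x _ => (w.poly j).hasDerivAt x)
      (fun x _ => (v.poly j).hasDerivAt x) (Continuous.intervalIntegrable (by fun_prop) _ _)
      (Continuous.intervalIntegrable (by fun_prop) _ _)
  have h2 := sum_cyclic_shift fun j => (w.poly j).eval (T.left j) * (v.poly j).eval (T.left j)
  have h3 : ∑ j, w.flux θ j * v.jump j + ∑ j, v.flux (1 - θ) j * w.jump j =
      ∑ j, (w.poly (j + 1)).eval (T.left (j + 1)) * (v.poly (j + 1)).eval (T.left (j + 1)) -
      ∑ j, (w.poly j).eval (T.right j) * (v.poly j).eval (T.right j) := by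
    rw [← Finset.sum_add_distrib, ← Finset.sum_sub_distrib]
    refine Finset.sum_congr rfl fun j _ => ?_
    simp only [flux, jump, traceMinus, tracePlus]
    ring
  simp only [dgForm, h1, Finset.sum_sub_distrib]
  linarith

lemma inner_D_skew (θ : ℝ) (w v : Vh T k) : ⟪D T k θ w, v⟫_ℝ = -⟪w, D T k (1 - θ) v⟫_ℝ := by
  rw [inner_D, dgForm_skew, ← inner_D, real_inner_comm]

lemma adjoint_D (θ : ℝ) : LinearMap.adjoint (D T k θ) = -D T k (1 - θ) := by
  symm
  rw [LinearMap.eq_adjoint_iff]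
  intro v w
  rw [LinearMap.neg_apply, inner_neg_left, inner_D_skew, neg_neg, sub_sub_cancel]

lemma dgForm_const_right (θ c : ℝ) (w : Vh T k) : dgForm θ w (const c) = 0 := by
  simp [dgForm, jump, tracePlus, traceMinus]

lemma D_const (θ c : ℝ) : D T k θ (const c) = 0 := by
  refine ext_inner_right ℝ fun v => ?_
  rw [inner_D, dgForm_skew, dgForm_const_right, inner_zero_left, neg_zero]

lemma D_mem (θ : ℝ) (w : Vh T k) : D T k θ w ∈ zeroMean T k := by
  rw [mem_zeroMean, inner_D, dgForm_const_right]

lemma D_centered (θ : ℝ) (v : Vh T k) : D T k θ (centered v) = D T k θ v := by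
  rw [centered, map_sub, D_const, sub_zero]

/-- Partial sums; the vanishing total is what makes the recursion hold at the wrap-around. -/
lemma exists_cyclic_primitive {N : ℕ} [NeZero N] (f : Fin N → ℝ) (hf : ∑ j, f j = 0) :
    ∃ S : Fin N → ℝ, (∀ j, S (j + 1) = S j + f j) ∧ ∀ j, |S j| ≤ ∑ i, |f i| := by
  obtain ⟨M, rfl⟩ : ∃ M, N = M + 1 := Nat.exists_eq_succ_of_ne_zero (NeZero.ne N)
  refine ⟨fun j => ∑ i ∈ Finset.univ.filter (· < j), f i, fun j => ?_, fun j => ?_⟩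
  · induction j using Fin.lastCases with
    | last =>
      have h : (Finset.univ : Finset (Fin (M + 1))) =
          insert (Fin.last M) (Finset.univ.filter (· < Fin.last M)) := by
        ext i
        simp only [Finset.mem_univ, Finset.mem_insert, Finset.mem_filter, true_and, true_iff]
        exact eq_or_lt_of_le (Fin.le_last i)
      rw [h, Finset.sum_insert (by simp)] at hf
      simp only [Fin.last_add_one, Fin.not_lt_zero, Finset.filter_false, Finset.sum_empty]
      linarith
    | cast i =>
      have h : Finset.univ.filter (· < i.castSucc + 1) =
          insert i.castSucc (Finset.univ.filter (· < i.castSucc)) := by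
        ext l
        simp only [Fin.coeSucc_eq_succ, Finset.mem_insert, Finset.mem_filter, Finset.mem_univ,
          true_and, Fin.lt_def, Fin.ext_iff, Fin.val_succ, Fin.val_castSucc]
        omega
      beta_reduce
      rw [h, Finset.sum_insert (by simp), add_comm]
  · refine (Finset.abs_sum_le_sum_abs _ _).trans
      (Finset.sum_le_sum_of_subset_of_nonneg (Finset.filter_subset _ _) fun i _ _ => abs_nonneg _)

/-- Discrete Poincaré inequality: `D_{h,θ}` has a bounded inverse on `Z_h`. -/
lemma exists_poincare (a b : ℝ) (k : ℕ) {θ : ℝ} (hθ : θ ≠ 1 / 2) : ∃ C : ℝ, 0 ≤ C ∧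
    ∀ (T : Mesh a b) (v : Vh T k), v ∈ zeroMean T k → ‖v‖ ≤ C * ‖D T k θ v‖ := by
  -- Duality: v = D_{h,1-θ} P for the Gauss-Radau projection P of a primitive of v. Skew-symmetry
  -- gives ‖v‖² = -(P, D_{h,θ} v), so it suffices to bound ‖P‖ by a multiple of ‖v‖.
  have hθ' : 1 - θ ≠ 1 / 2 := fun h => hθ (by linarith)
  obtain ⟨C, hC, hGR⟩ := exists_isGaussRadau k hθ'
  obtain ⟨S, hS, hproj⟩ := exists_brokenProj_bound k
  -- The absolute value keeps the constant nonnegative: a < b is known only once a mesh is given.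
  refine ⟨√(b - a) * ((C * (1 + S) + S) * (2 * (|b - a| + 1))), by positivity, fun T v hv => ?_⟩
  have hab := b_sub_a_pos T
  rw [abs_of_pos hab]
  set A := ∑ j, ∫ x in (T.left j)..(T.right j), |(v.poly j).eval x| with hA
  have hAv : A ≤ (b - a + 1) * ‖v‖ := sum_integral_abs_le v
  have hle : ∀ j, ∫ x in (T.left j)..(T.right j), |(v.poly j).eval x| ≤ A := fun j =>
    Finset.single_le_sum (f := fun j => ∫ x in (T.left j)..(T.right j), |(v.poly j).eval x|)
      (fun i _ => intervalIntegral.integral_nonneg (T.left_lt_right i).le fun _ _ => abs_nonneg _)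
      (Finset.mem_univ j)
  obtain ⟨P0, hP0, hP0b⟩ := exists_cyclic_primitive
    (fun j => ∫ x in (T.left j)..(T.right j), (v.poly j).eval x)
    (by rw [← inner_const_one]; exact hv)
  -- A primitive of v, with starting values that make it continuous across all interfaces, the
  -- periodic one included because v has zero mean.
  let ψ : Fin T.N → ℝ → ℝ := fun j x => P0 j + ∫ y in (T.left j)..x, (v.poly j).eval y
  let g : Fin T.N → ℝ → ℝ := fun j x => (v.poly j).eval x
  have hg : ∀ j, Continuous (g j) := fun j => (v.poly j).continuous
  have hψ : ∀ j x, HasDerivAt (ψ j) (g j x) x := fun j x =>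
    (intervalIntegral.integral_hasDerivAt_right ((hg j).intervalIntegrable _ _)
      ((hg j).stronglyMeasurableAtFilter _ _) (hg j).continuousAt).const_add _
  have hψc : ∀ j, Continuous (ψ j) := fun j =>
    continuous_iff_continuousAt.mpr fun x => (hψ j x).continuousAt
  have hmatch : ∀ j, ψ (j + 1) (T.left (j + 1)) = ψ j (T.right j) := by
    intro j
    simp only [ψ, intervalIntegral.integral_same, add_zero, hP0]
  have hψb : ∀ j, ∀ x ∈ Icc (T.left j) (T.right j), |ψ j x| ≤ 2 * A := by
    intro j x hx
    have h1 : |P0 j| ≤ A := (hP0b j).trans (Finset.sum_le_sum fun i _ =>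
      intervalIntegral.abs_integral_le_integral_abs (T.left_lt_right i).le)
    have h2 : |∫ y in (T.left j)..x, (v.poly j).eval y| ≤ A := by
      refine (intervalIntegral.abs_integral_le_integral_abs hx.1).trans (le_trans ?_ (hle j))
      refine intervalIntegral.integral_mono_interval le_rfl hx.1 hx.2
        (Filter.Eventually.of_forall fun _ => abs_nonneg _)
        (Continuous.intervalIntegrable (by fun_prop) _ _)
    exact (abs_add_le _ _).trans (by linarith)
  have hπ : ∀ j, ∀ x ∈ Icc (T.left j) (T.right j),
      |((brokenProj k ψ).poly j).eval x| ≤ S * (2 * A) := by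
    intro j x hx
    have := hproj a b T ψ hψc j 0 (by simp) (2 * A)
      (fun y hy => by simpa using hψb j y hy) x hx
    simpa using this
  obtain ⟨P, hP, hPb⟩ := hGR a b T ψ hψc hmatch ((1 + S) * (2 * A)) (fun j x hx => by
    refine (abs_sub _ _).trans ?_
    linarith [hψb j x hx, hπ j x hx])
  have hPn : ‖P‖ ≤ √(b - a) * ((C * (1 + S) + S) * (2 * A)) := by
    refine norm_le_of_abs_le P fun j x hx => ?_
    have e : (P.poly j).eval x = ((P.poly j).eval x - ((brokenProj k ψ).poly j).eval x) +
      ((brokenProj k ψ).poly j).eval x := by ring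
    rw [e]
    refine (abs_add_le _ _).trans ?_
    linarith [hPb j x hx, hπ j x hx]
  have hD := hP.D_eq hψ hg hmatch
  have h1 : ‖v‖ ^ 2 ≤ ‖P‖ * ‖D T k θ v‖ := by
    calc ‖v‖ ^ 2 = ⟪v, v⟫_ℝ := (real_inner_self_eq_norm_sq v).symm
      _ = ⟪brokenProj k g, v⟫_ℝ := (inner_brokenProj hg v).symm
      _ = -⟪P, D T k θ v⟫_ℝ := by rw [← hD, inner_D_skew, sub_sub_cancel]
      _ ≤ |⟪P, D T k θ v⟫_ℝ| := neg_le_abs _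
      _ ≤ _ := abs_real_inner_le_norm _ _
  have h2 : ‖P‖ ≤ √(b - a) * ((C * (1 + S) + S) * (2 * (b - a + 1))) * ‖v‖ := by
    refine hPn.trans ?_
    calc √(b - a) * ((C * (1 + S) + S) * (2 * A))
        ≤ √(b - a) * ((C * (1 + S) + S) * (2 * ((b - a + 1) * ‖v‖))) := by gcongr
      _ = _ := by ring
  rcases (norm_nonneg v).eq_or_lt with h0 | hpos
  · rw [← h0]; positivity
  · refine le_of_mul_le_mul_left ?_ hpos
    calc ‖v‖ * ‖v‖ = ‖v‖ ^ 2 := (sq _).symm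
      _ ≤ ‖P‖ * ‖D T k θ v‖ := h1
      _ ≤ (√(b - a) * ((C * (1 + S) + S) * (2 * (b - a + 1))) * ‖v‖) * ‖D T k θ v‖ := by gcongr
      _ = _ := by ring

/-- The Poincaré inequality makes D_{h,θ} injective on Z_h, which it maps into itself; finite
dimension gives surjectivity, so `Function.invFunOn` returns a true preimage. -/
lemma Dinv_spec {θ : ℝ} (hθ : θ ≠ 1 / 2) {y : Vh T k} (hy : y ∈ zeroMean T k) :
    Dinv θ y ∈ zeroMean T k ∧ D T k θ (Dinv θ y) = y := by
  obtain ⟨C, _, hC⟩ := exists_poincare a b k hθ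
  let A : zeroMean T k →ₗ[ℝ] zeroMean T k := (D T k θ).restrict fun v _ => D_mem θ v
  have hinj : Function.Injective A := by
    rw [injective_iff_map_eq_zero]
    intro v hv
    have h0 : D T k θ v = 0 := congrArg Subtype.val hv
    have := hC T v v.2
    rw [h0, norm_zero, mul_zero] at this
    exact Subtype.ext (norm_le_zero_iff.mp this)
  obtain ⟨v, hv⟩ := (LinearMap.injective_iff_surjective.mp hinj) ⟨y, hy⟩
  have hex : ∃ v ∈ Zh T k, D T k θ v = y := ⟨v, v.2, congrArg Subtype.val hv⟩
  exact ⟨Function.invFunOn_mem hex, Function.invFunOn_eq hex⟩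

end Vh

/-! ### Smooth periodic functions -/

/-- `f` is `(b - a)`-periodic and of class `C^n`, and its derivatives up to order `n` are bounded
by `W`. -/
structure BoundedSmooth (a b : ℝ) (n : ℕ) (W : ℝ) (f : ℝ → ℝ) : Prop where
  contDiff : ContDiff ℝ n f
  periodic : Function.Periodic f (b - a)
  bound : ∀ i ≤ n, ∀ x, |iteratedDeriv i f x| ≤ W

lemma iteratedDeriv_iteratedDeriv (i j : ℕ) (f : ℝ → ℝ) :
    iteratedDeriv i (iteratedDeriv j f) = iteratedDeriv (i + j) f := by
  rw [iteratedDeriv_eq_iterate, iteratedDeriv_eq_iterate, iteratedDeriv_eq_iterate,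
    Function.iterate_add_apply]

lemma contDiff_iteratedDeriv {f : ℝ → ℝ} {n i j : ℕ} (hf : ContDiff ℝ n f) (hij : i + j ≤ n) :
    ContDiff ℝ i (iteratedDeriv j f) := by
  rw [contDiff_nat_iff_iteratedDeriv] at hf ⊢
  constructor
  · intro m hm
    rw [iteratedDeriv_iteratedDeriv]
    exact hf.1 _ (by omega)
  · intro m hm
    rw [iteratedDeriv_iteratedDeriv]
    exact hf.2 _ (by omega)

lemma periodic_iteratedDeriv {f : ℝ → ℝ} {c : ℝ} (hf : Function.Periodic f c) (n : ℕ) :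
    Function.Periodic (iteratedDeriv n f) c := by
  intro x
  have h := congrFun (iteratedDeriv_comp_add_const n f c) x
  rw [← h]
  congr 1
  exact funext hf

namespace BoundedSmooth

variable {a b W : ℝ} {n : ℕ} {f : ℝ → ℝ}

lemma nonneg (hf : BoundedSmooth a b n W f) : 0 ≤ W :=
  (abs_nonneg _).trans (hf.bound 0 (Nat.zero_le _) 0)

lemma iteratedDeriv (hf : BoundedSmooth a b n W f) {i m : ℕ} (him : m + i ≤ n) :
    BoundedSmooth a b m W (iteratedDeriv i f) where
  contDiff := contDiff_iteratedDeriv hf.contDiff him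
  periodic := periodic_iteratedDeriv hf.periodic i
  bound l hl x := by
    rw [iteratedDeriv_iteratedDeriv]
    exact hf.bound _ (by omega) x

lemma apply_eq (hf : BoundedSmooth a b n W f) : f a = f b := by
  have := hf.periodic a
  rw [add_sub_cancel] at this
  exact this.symm

lemma continuous (hf : BoundedSmooth a b n W f) : Continuous f := hf.contDiff.continuous

lemma hasDerivAt (hf : BoundedSmooth a b n W f) (hn : 1 ≤ n) (x : ℝ) :
    HasDerivAt f (deriv f x) x :=
  (hf.contDiff.differentiable
    (by exact_mod_cast Nat.one_le_iff_ne_zero.mp hn)).differentiableAt.hasDerivAt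

lemma continuous_deriv (hf : BoundedSmooth a b n W f) (hn : 1 ≤ n) : Continuous (deriv f) :=
  hf.contDiff.continuous_deriv (by exact_mod_cast hn)

lemma integral_deriv (hf : BoundedSmooth a b n W f) (hn : 1 ≤ n) : ∫ x in a..b, deriv f x = 0 := by
  rw [intervalIntegral.integral_eq_sub_of_hasDerivAt (fun x _ => hf.hasDerivAt hn x)
    ((hf.continuous_deriv hn).intervalIntegrable _ _), hf.apply_eq, sub_self]

lemma integral_iteratedDeriv (hf : BoundedSmooth a b n W f) {i : ℕ} (hi : 1 ≤ i) (hin : i ≤ n) :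
    ∫ x in a..b, _root_.iteratedDeriv i f x = 0 := by
  obtain ⟨i, rfl⟩ := Nat.exists_eq_add_of_le' hi
  rw [iteratedDeriv_succ]
  exact (hf.iteratedDeriv (i := i) (m := 1) (by omega)).integral_deriv le_rfl

lemma sub_const (hf : BoundedSmooth a b n W f) {c V : ℝ} (hc : |c| ≤ V) :
    BoundedSmooth a b n (W + V) (fun x => f x - c) where
  contDiff := hf.contDiff.sub contDiff_const
  periodic x := by simp only [hf.periodic x]
  bound i hi x := by
    rw [iteratedDeriv_fun_sub (hf.contDiff.of_le (by exact_mod_cast hi)).contDiffAt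
      contDiffAt_const, iteratedDeriv_const]
    refine (abs_sub _ _).trans (add_le_add (hf.bound i hi x) ?_)
    split_ifs
    · exact hc
    · simpa using (abs_nonneg c).trans hc

end BoundedSmooth

namespace Vh

variable {a b : ℝ} {T : Mesh a b} {k : ℕ}

/-! ### Linearity and stability of the `L²` projection -/

/-- The combination has the shape of a Taylor remainder, to which the projection is applied later.
-/
lemma pairing_sub_sum {ι : Type*} (s : Finset ι) {f : ℝ → ℝ} {g : ι → ℝ → ℝ} (c : ι → ℝ)
    (hf : Continuous f) (hg : ∀ i ∈ s, Continuous (g i)) (v : Vh T k) :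
    pairing (fun x => f x - ∑ i ∈ s, c i * g i x) v =
      pairing f v - ∑ i ∈ s, c i * pairing (g i) v := by
  simp only [pairing, Finset.mul_sum]
  rw [Finset.sum_comm, ← Finset.sum_sub_distrib]
  refine Finset.sum_congr rfl fun j _ => ?_
  have hi : ∀ i ∈ s, IntervalIntegrable (fun x => c i * (g i x * (v.poly j).eval x))
      MeasureTheory.volume (T.left j) (T.right j) := fun i hi => by
    have := hg i hi
    exact Continuous.intervalIntegrable (by fun_prop) _ _
  simp only [sub_mul, Finset.sum_mul, mul_assoc]
  rw [intervalIntegral.integral_sub (Continuous.intervalIntegrable (by fun_prop) _ _)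
    (Continuous.intervalIntegrable (continuous_finsetSum s fun i hi => by
      have := hg i hi
      fun_prop) _ _), intervalIntegral.integral_finsetSum hi]
  simp only [intervalIntegral.integral_const_mul]

lemma proj0_sub_sum {ι : Type*} (s : Finset ι) {f : ℝ → ℝ} {g : ι → ℝ → ℝ} (c : ι → ℝ)
    (hf : Continuous f) (hg : ∀ i ∈ s, Continuous (g i)) :
    proj0 T k (fun x => f x - ∑ i ∈ s, c i * g i x) =
      proj0 T k f - ∑ i ∈ s, c i • proj0 T k (g i) := by
  refine ext_inner_right ℝ fun v => ?_
  have hc : Continuous (fun x => f x - ∑ i ∈ s, c i * g i x) :=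
    hf.sub (continuous_finsetSum s fun i hi => continuous_const.mul (hg i hi))
  rw [inner_proj0 hc,
    pairing_sub_sum s c hf hg, inner_sub_left, inner_proj0 hf, sum_inner]
  congr 1
  refine Finset.sum_congr rfl fun i hi => ?_
  rw [real_inner_smul_left, inner_proj0 (hg i hi)]

lemma proj0_const_mul {f : ℝ → ℝ} (hf : Continuous f) (c : ℝ) :
    proj0 T k (fun x => c * f x) = c • proj0 T k f := by
  refine ext_inner_right ℝ fun v => ?_
  rw [inner_proj0 (w := fun x => c * f x) (by fun_prop), real_inner_smul_left, inner_proj0 hf,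
    pairing, pairing, Finset.mul_sum]
  simp only [mul_assoc, intervalIntegral.integral_const_mul]

lemma proj0_sub_const {f : ℝ → ℝ} (hf : Continuous f) (c : ℝ) :
    proj0 T k (fun x => f x - c) = proj0 T k f - const c := by
  refine ext_inner_right ℝ fun v => ?_
  rw [inner_proj0 (w := fun x => f x - c) (by fun_prop), inner_sub_left, inner_proj0 hf,
    inner_def, pairing, pairing, ← Finset.sum_sub_distrib]
  refine Finset.sum_congr rfl fun j _ => ?_
  rw [← intervalIntegral.integral_sub (Continuous.intervalIntegrable (by fun_prop) _ _)
    (Continuous.intervalIntegrable (by fun_prop) _ _)]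
  simp [sub_mul]

lemma exists_proj0_norm_le (a b : ℝ) (k : ℕ) : ∃ S : ℝ, 0 ≤ S ∧
    ∀ (T : Mesh a b) (f : ℝ → ℝ) (W : ℝ),
    Continuous f → (∀ x, |f x| ≤ W) → ‖proj0 T k f‖ ≤ S * W := by
  obtain ⟨S, hS, h⟩ := exists_brokenProj_bound k
  refine ⟨√(b - a) * S, by positivity, fun T f W hf hW => ?_⟩
  rw [mul_assoc]
  refine norm_le_of_abs_le _ fun j x hx => ?_
  have := h a b T (fun _ => f) (fun _ => hf) j 0 (by simp) W (fun x _ => by simpa using hW x) x hx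
  simpa [proj0_eq_brokenProj] using this

lemma proj0_mem {f : ℝ → ℝ} (hf : Continuous f) (h0 : ∫ x in a..b, f x = 0) :
    proj0 T k f ∈ zeroMean T k := by
  rw [mem_zeroMean, inner_proj0_const hf, h0]

/-! ### Chains of operators -/

/-- One inverse `D_{h,θ}⁻¹` preserves the order of approximation. -/
lemma exists_Dinv_error (a b : ℝ) (k : ℕ) {θ : ℝ} (hθ : θ ≠ 1 / 2) : ∃ C : ℝ, 0 ≤ C ∧
    ∀ (T : Mesh a b) (F : ℝ → ℝ) (W : ℝ), BoundedSmooth a b (k + 1) W F → ∫ x in a..b, F x = 0 →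
    ∀ y ∈ zeroMean T k, ‖Dinv θ y - proj0 T k F‖ ≤
      C * (‖y - proj0 T k (deriv F)‖ + W * T.h ^ (k + 1)) := by
  obtain ⟨C₁, hC₁, hP⟩ := exists_poincare a b k hθ
  obtain ⟨C₂, hC₂, hGR⟩ := exists_isGaussRadau k hθ
  obtain ⟨C₃, hC₃, hpr⟩ := exists_proj0_error k
  refine ⟨C₁ + √(b - a) * (C₂ * C₃), by positivity, fun T F W hF h0 y hy => ?_⟩
  have hk : 1 ≤ k + 1 := by omega
  obtain ⟨P, hPG, hPb⟩ := hGR a b T (fun _ => F) (fun _ => hF.continuous)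
    (fun j => T.left_succ_eq hF.apply_eq j) (C₃ * (W * T.h ^ (k + 1)))
    (fun j x hx => hpr a b T F W hF.contDiff (hF.bound _ le_rfl) j x hx)
  have hD : D T k θ P = proj0 T k (deriv F) :=
    hPG.D_eq (g := fun _ => deriv F) (fun j x => hF.hasDerivAt hk x)
      (fun _ => hF.continuous_deriv hk) (fun j => T.left_succ_eq hF.apply_eq j)
  obtain ⟨hmem, hDinv⟩ := Dinv_spec hθ hy
  -- P may have nonzero mean (when k = 0 the moment conditions are void), so it is centred. D_{h,θ}
  -- annihilates constants, hence its image is still Π₀ F'.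
  have h1 : ‖Dinv θ y - centered P‖ ≤ C₁ * ‖y - proj0 T k (deriv F)‖ := by
    have := hP T (Dinv θ y - centered P) (Submodule.sub_mem _ hmem (centered_mem P))
    rwa [map_sub, hDinv, D_centered, hD] at this
  have h2 : ‖P - proj0 T k F‖ ≤ √(b - a) * (C₂ * (C₃ * (W * T.h ^ (k + 1)))) :=
    norm_le_of_abs_le _ fun j x hx => by
      rw [poly_sub, Polynomial.eval_sub]
      exact hPb j x hx
  have h3 : centered P - proj0 T k F = centered (P - proj0 T k F) := by
    rw [centered, centered, inner_sub_left, mem_zeroMean.mp (proj0_mem hF.continuous h0), sub_zero]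
    abel
  have h4 : ‖centered P - proj0 T k F‖ ≤ √(b - a) * (C₂ * (C₃ * (W * T.h ^ (k + 1)))) := by
    rw [h3]
    exact (norm_centered_le _).trans h2
  have hWh : 0 ≤ W * T.h ^ (k + 1) := mul_nonneg hF.nonneg (pow_nonneg T.h_pos.le _)
  have hs : 0 ≤ √(b - a) * (C₂ * C₃) := by positivity
  calc ‖Dinv θ y - proj0 T k F‖ = ‖(Dinv θ y - centered P) + (centered P - proj0 T k F)‖ := by
        congr 1; abel
    _ ≤ C₁ * ‖y - proj0 T k (deriv F)‖ + √(b - a) * (C₂ * (C₃ * (W * T.h ^ (k + 1)))) :=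
        (norm_add_le _ _).trans (add_le_add h1 h4)
    _ ≤ _ := by
        have e1 := mul_nonneg hC₁ hWh
        have e2 := mul_nonneg hs (norm_nonneg (y - proj0 T k (deriv F)))
        nlinarith

/-- The product `D_{h,t₁} ⋯ D_{h,t_n}`. -/
def chain (T : Mesh a b) (k : ℕ) (l : List ℝ) : Module.End ℝ (Vh T k) := (l.map (D T k)).prod

/-- The operator `D_{h,t_n}⁻¹ ⋯ D_{h,t₁}⁻¹`. -/
def chainInv (l : List ℝ) (y : Vh T k) : Vh T k := l.foldl (fun v t => Dinv t v) y

lemma chain_cons (t : ℝ) (l : List ℝ) (v : Vh T k) :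
    chain T k (t :: l) v = D T k t (chain T k l v) := by
  simp [chain]

@[simp] lemma chain_nil : chain T k [] = 1 := rfl

lemma chain_append (l l' : List ℝ) : chain T k (l ++ l') = chain T k l * chain T k l' := by
  simp [chain]

lemma chainInv_cons (t : ℝ) (l : List ℝ) (y : Vh T k) :
    chainInv (t :: l) y = chainInv l (Dinv t y) := rfl

lemma chainInv_spec {l : List ℝ} (hl : ∀ t ∈ l, t ≠ 1 / 2) {y : Vh T k} (hy : y ∈ zeroMean T k) :
    chainInv l y ∈ zeroMean T k ∧ chain T k l (chainInv l y) = y := by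
  induction l generalizing y with
  | nil => exact ⟨hy, rfl⟩
  | cons t l ih =>
    obtain ⟨h1, h2⟩ := Dinv_spec (hl t (by simp)) hy
    obtain ⟨h3, h4⟩ := ih (fun s hs => hl s (by simp [hs])) h1
    exact ⟨h3, by rw [chainInv_cons, chain_cons, h4, h2]⟩

lemma chain_const {l : List ℝ} (hl : l ≠ []) (c : ℝ) : chain T k l (const c) = 0 := by
  induction l with
  | nil => exact absurd rfl hl
  | cons t l ih =>
    rw [chain_cons]
    rcases eq_or_ne l [] with rfl | h
    · exact D_const t c
    · rw [ih h, map_zero]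

lemma chain_mem (l : List ℝ) {v : Vh T k} (hv : v ∈ zeroMean T k) :
    chain T k l v ∈ zeroMean T k := by
  cases l with
  | nil => exact hv
  | cons t l => rw [chain_cons]; exact D_mem _ _

lemma exists_chain_poincare (a b : ℝ) (k : ℕ) {l : List ℝ} (hl : ∀ t ∈ l, t ≠ 1 / 2) :
    ∃ C : ℝ, 0 ≤ C ∧
    ∀ (T : Mesh a b) (v : Vh T k), v ∈ zeroMean T k → ‖v‖ ≤ C * ‖chain T k l v‖ := by
  induction l with
  | nil => exact ⟨1, zero_le_one, fun T v _ => by simp⟩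
  | cons t l ih =>
    obtain ⟨C₁, h₁, hC₁⟩ := ih fun s hs => hl s (by simp [hs])
    obtain ⟨C₂, h₂, hC₂⟩ := exists_poincare a b k (hl t (by simp))
    refine ⟨C₁ * C₂, by positivity, fun T v hv => (hC₁ T v hv).trans ?_⟩
    rw [chain_cons, mul_assoc]
    exact mul_le_mul_of_nonneg_left (hC₂ T _ (chain_mem l hv)) h₁

/-- A chain of operators controls the norm up to the mean value. -/
lemma exists_norm_le_chain (a b : ℝ) (k : ℕ) {l : List ℝ} (hl : ∀ t ∈ l, t ≠ 1 / 2) (hne : l ≠ []) :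
    ∃ C : ℝ, 0 ≤ C ∧ ∀ (T : Mesh a b) (v : Vh T k),
      ‖v‖ ≤ C * (‖chain T k l v‖ + |⟪v, const 1⟫_ℝ|) := by
  obtain ⟨C, h, hC⟩ := exists_chain_poincare a b k hl
  refine ⟨C + √(b - a) / |b - a|, by positivity, fun T v => ?_⟩
  have hab := b_sub_a_pos T
  have h1 := hC T _ (centered_mem v)
  have h2 : chain T k l (centered v) = chain T k l v := by
    rw [centered, map_sub, chain_const hne, sub_zero]
  rw [h2] at h1
  have h3 : ‖(const (⟪v, const 1⟫_ℝ / (b - a)) : Vh T k)‖ ≤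
      √(b - a) * (|⟪v, const 1⟫_ℝ| / |b - a|) := by
    refine norm_le_of_abs_le _ fun j x _ => ?_
    simp [abs_div]
  have h4 : v = centered v + const (⟪v, const 1⟫_ℝ / (b - a)) := by simp [centered]
  have e : ‖v‖ ≤ ‖centered v‖ + ‖(const (⟪v, const 1⟫_ℝ / (b - a)) : Vh T k)‖ := by
    conv_lhs => rw [h4]
    exact norm_add_le _ _
  have h5 : √(b - a) * (|⟪v, const 1⟫_ℝ| / |b - a|) = √(b - a) / |b - a| * |⟪v, const 1⟫_ℝ| := by
    ring
  have h6 : 0 ≤ √(b - a) / |b - a| * ‖chain T k l v‖ := by positivity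
  have h7 : 0 ≤ C * |⟪v, const 1⟫_ℝ| := by positivity
  nlinarith

/-- Each inverse lowers by one the order of the derivative whose L² projection is approximated, and
adds one error of order h^{k+1}. The induction needs an arbitrary initial constant A, since each
step enlarges it to C₁(A + 1). Derivatives of periodic functions have zero mean, so the mean must be
prescribed only for w itself. -/
lemma exists_chainInv_error (a b : ℝ) (k : ℕ) (l : List ℝ) (hl : ∀ t ∈ l, t ≠ 1 / 2) :
    ∀ A : ℝ, 0 ≤ A → ∃ C : ℝ, 0 ≤ C ∧ ∀ (T : Mesh a b) (w : ℝ → ℝ) (W : ℝ),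
    BoundedSmooth a b (k + l.length) W w → ∫ x in a..b, w x = 0 → ∀ y ∈ zeroMean T k,
    ‖y - proj0 T k (iteratedDeriv l.length w)‖ ≤ A * (W * T.h ^ (k + 1)) →
    ‖chainInv l y - proj0 T k w‖ ≤ C * (W * T.h ^ (k + 1)) := by
  induction l with
  | nil =>
    intro A hA
    refine ⟨A, hA, fun T w W _ _ y _ h => ?_⟩
    simpa [chainInv] using h
  | cons t l ih =>
    intro A hA
    obtain ⟨C₁, hC₁, h₁⟩ := exists_Dinv_error a b k (hl t (by simp))
    obtain ⟨C, hC, h⟩ := ih (fun s hs => hl s (by simp [hs])) (C₁ * (A + 1)) (by positivity)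
    refine ⟨C, hC, fun T w W hw h0 y hy hyw => ?_⟩
    rw [List.length_cons] at hw hyw
    have hw' : BoundedSmooth a b (k + l.length) W w :=
      ⟨hw.contDiff.of_le (by exact_mod_cast (by omega : k + l.length ≤ k + (l.length + 1))),
        hw.periodic, fun i hi => hw.bound i (by omega)⟩
    have hF : BoundedSmooth a b (k + 1) W (iteratedDeriv l.length w) :=
      hw.iteratedDeriv (by omega)
    have hF0 : ∫ x in a..b, iteratedDeriv l.length w x = 0 := by
      rcases Nat.eq_zero_or_pos l.length with h | h
      · simpa [h] using h0
      · exact hw'.integral_iteratedDeriv h (by omega)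
    refine h T w W hw' h0 _ (Dinv_spec (hl t (by simp)) hy).1 ?_
    refine (h₁ T _ W hF hF0 y hy).trans ?_
    rw [← iteratedDeriv_succ]
    have : ‖y - proj0 T k (iteratedDeriv (l.length + 1) w)‖ + W * T.h ^ (k + 1) ≤
        (A + 1) * (W * T.h ^ (k + 1)) := by linarith
    calc _ ≤ C₁ * ((A + 1) * (W * T.h ^ (k + 1))) := by gcongr
      _ = _ := by ring

/-! ### The operators `L_h` and `Π` -/

/-- The flux parameters of the factors of `L_h`, from left to right. -/
def params (q : ℕ) (θ₀ : ℝ) (θ : Fin (q / 2) → ℝ) : List ℝ :=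
  ((List.ofFn θ).map (fun t => 1 - t)).reverse ++ (if Even q then [] else [θ₀]) ++ List.ofFn θ

lemma length_params (q : ℕ) (θ₀ : ℝ) (θ : Fin (q / 2) → ℝ) : (params q θ₀ θ).length = q := by
  rcases Nat.even_or_odd q with h | h
  · simp only [params, List.length_append, List.length_reverse, List.length_map, List.length_ofFn,
      if_pos h, List.length_nil]
    obtain ⟨m, rfl⟩ := h
    omega
  · simp only [params, List.length_append, List.length_reverse, List.length_map, List.length_ofFn,
      if_neg (Nat.not_even_iff_odd.mpr h), List.length_singleton]
    obtain ⟨m, rfl⟩ := h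
    omega

lemma params_ne_half {q : ℕ} {θ₀ : ℝ} {θ : Fin (q / 2) → ℝ} (hθ₀ : Odd q → θ₀ ≠ 1 / 2)
    (hθ : ∀ i, θ i ≠ 1 / 2) : ∀ t ∈ params q θ₀ θ, t ≠ 1 / 2 := by
  intro t ht
  simp only [params, List.mem_append, List.mem_reverse, List.mem_map, List.mem_ofFn] at ht
  rcases ht with (⟨s, ⟨i, rfl⟩, rfl⟩ | ht) | ⟨i, rfl⟩
  · intro h
    exact hθ i (by linarith)
  · split_ifs at ht with hq
    · simp at ht
    · rw [List.mem_singleton.mp ht]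
      exact hθ₀ (Nat.not_even_iff_odd.mp hq)
  · exact hθ i

/-- Transposition reverses the order and turns each D_{h,t} into -D_{h,1-t}. -/
lemma adjoint_chain (l : List ℝ) : LinearMap.adjoint (chain T k l) =
    (-1 : ℝ) ^ l.length • chain T k (l.map (fun t => 1 - t)).reverse := by
  induction l with
  | nil => simp
  | cons t l ih =>
    have e : chain T k (t :: l) = D T k t ∘ₗ chain T k l := LinearMap.ext fun v => chain_cons t l v
    rw [e, LinearMap.adjoint_comp, ih, adjoint_D, List.map_cons, List.reverse_cons, chain_append,
      List.length_cons, pow_succ]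
    ext v
    simp [chain]

/-- The sign in `Lh` cancels the (-1)^γ of the transpose. What remains is a plain product over the
list that also defines Π, which makes the exact relation between L_h and Π visible. -/
lemma Lh_eq_chain (T : Mesh a b) (k q : ℕ) (β θ₀ : ℝ) (θ : Fin (q / 2) → ℝ) :
    Lh T k q β θ₀ θ = β • chain T k (params q θ₀ θ) := by
  have hK : K T k θ = chain T k (List.ofFn θ) := by
    rw [K, chain, List.map_ofFn]
    rfl
  have hs : ((-1 : ℝ) ^ (q / 2) * β) * (-1) ^ (q / 2) = β := by
    rw [mul_right_comm, ← mul_pow]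
    simp
  rw [Lh, hK, adjoint_chain, List.length_ofFn, params]
  split_ifs with h
  · rw [List.append_nil, chain_append, smul_mul_assoc, smul_smul, hs]
  · have e : chain T k [θ₀] = D T k θ₀ := by simp [chain]
    rw [chain_append, chain_append, e, smul_mul_assoc, smul_mul_assoc, smul_smul, hs]

lemma proj_eq_chainInv (T : Mesh a b) (k q : ℕ) (θ₀ : ℝ) (θ : Fin (q / 2) → ℝ) (w : ℝ → ℝ) :
    proj T k q θ₀ θ w = chainInv (params q θ₀ θ) (proj0 T k (iteratedDeriv q w)) +
      const ((∫ x in a..b, w x) / (b - a)) := by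
  simp only [proj, chainInv, params, List.foldl_append, List.foldl_reverse, List.foldr_map]
  split_ifs <;> rfl

section projection

variable {q : ℕ} {θ₀ : ℝ} {θ : Fin (q / 2) → ℝ}

lemma params_ne_nil (hq : 1 ≤ q) : params q θ₀ θ ≠ [] := by
  rw [← List.length_pos_iff, length_params]
  omega

lemma chain_proj (hq : 1 ≤ q) (hθ₀ : Odd q → θ₀ ≠ 1 / 2) (hθ : ∀ i, θ i ≠ 1 / 2) {W : ℝ}
    {w : ℝ → ℝ} (hw : BoundedSmooth a b q W w) :
    chain T k (params q θ₀ θ) (proj T k q θ₀ θ w) = proj0 T k (iteratedDeriv q w) := by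
  have hmem : proj0 T k (iteratedDeriv q w) ∈ zeroMean T k :=
    proj0_mem (hw.iteratedDeriv (i := q) (m := 0) (by omega)).continuous
      (hw.integral_iteratedDeriv hq le_rfl)
  rw [proj_eq_chainInv, map_add, chain_const (params_ne_nil hq), add_zero,
    (chainInv_spec (params_ne_half hθ₀ hθ) hmem).2]

/-- Π inverts the very factors of L_h, and the mean value that it adds is annihilated because there
is at least one factor. -/
lemma Lh_proj (hq : 1 ≤ q) (hθ₀ : Odd q → θ₀ ≠ 1 / 2) (hθ : ∀ i, θ i ≠ 1 / 2) {W β : ℝ}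
    {w : ℝ → ℝ} (hw : BoundedSmooth a b q W w) :
    Lh T k q β θ₀ θ (proj T k q θ₀ θ w) = proj0 T k (Lop β q w) := by
  rw [Lh_eq_chain, LinearMap.smul_apply, chain_proj hq hθ₀ hθ hw, ← proj0_const_mul
    (hw.iteratedDeriv (i := q) (m := 0) (by omega)).continuous]
  rfl

lemma inner_proj_const (hq : 1 ≤ q) (hθ₀ : Odd q → θ₀ ≠ 1 / 2) (hθ : ∀ i, θ i ≠ 1 / 2) {W : ℝ}
    {w : ℝ → ℝ} (hw : BoundedSmooth a b q W w) :
    ⟪proj T k q θ₀ θ w, const 1⟫_ℝ = ∫ x in a..b, w x := by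
  have hmem : proj0 T k (iteratedDeriv q w) ∈ zeroMean T k :=
    proj0_mem (hw.iteratedDeriv (i := q) (m := 0) (by omega)).continuous
      (hw.integral_iteratedDeriv hq le_rfl)
  rw [proj_eq_chainInv, inner_add_left,
    mem_zeroMean.mp (chainInv_spec (params_ne_half hθ₀ hθ) hmem).1, inner_const_const, zero_add,
    div_mul_cancel₀ _ (ne_of_gt (b_sub_a_pos T))]

/-- Approximation error of the projection `Π`. -/
lemma exists_proj_error (a b : ℝ) (k : ℕ) (hq : 1 ≤ q) (hθ₀ : Odd q → θ₀ ≠ 1 / 2)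
    (hθ : ∀ i, θ i ≠ 1 / 2) : ∃ C : ℝ, 0 ≤ C ∧ ∀ (T : Mesh a b) (w : ℝ → ℝ) (W : ℝ),
    BoundedSmooth a b (k + q) W w →
      ‖proj T k q θ₀ θ w - proj0 T k w‖ ≤ C * (W * T.h ^ (k + 1)) := by
  -- The initial constant is 0, as the chain of inverses starts from the exact projection of the
  -- q-th derivative. Subtracting the mean of w at most doubles W, hence 2 * C.
  obtain ⟨C, hC, h⟩ := exists_chainInv_error a b k (params q θ₀ θ) (params_ne_half hθ₀ hθ) 0 le_rfl
  refine ⟨2 * C, by positivity, fun T w W hw => ?_⟩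
  have hab := b_sub_a_pos T
  set c := (∫ x in a..b, w x) / (b - a) with hc
  have hcW : |c| ≤ W := by
    rw [hc, abs_div, abs_of_pos hab, div_le_iff₀ hab]
    have := intervalIntegral.norm_integral_le_of_norm_le_const (f := w) (a := a) (b := b) (C := W)
      (fun x _ => by simpa using hw.bound 0 (Nat.zero_le _) x)
    rwa [abs_of_pos hab] at this
  have hw0 := hw.sub_const hcW
  have hmean : ∫ x in a..b, (w x - c) = 0 := by
    rw [intervalIntegral.integral_sub (hw.continuous.intervalIntegrable _ _)
      (continuous_const.intervalIntegrable _ _), intervalIntegral.integral_const, smul_eq_mul, hc]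
    field_simp
    ring
  have hder : iteratedDeriv q (fun x => w x - c) = iteratedDeriv q w := by
    ext x
    rw [iteratedDeriv_fun_sub
      (hw.contDiff.of_le (by exact_mod_cast (by omega : q ≤ k + q))).contDiffAt
      contDiffAt_const, iteratedDeriv_const, if_neg (by omega), sub_zero]
  have hmem : proj0 T k (iteratedDeriv q w) ∈ zeroMean T k :=
    proj0_mem (hw.iteratedDeriv (i := q) (m := 0) (by omega)).continuous
      (hw.integral_iteratedDeriv hq (by omega))
  have key := h T (fun x => w x - c) (W + W) (by rw [length_params]; exact hw0) hmean _ hmem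
    (by rw [length_params, hder]; simp)
  rw [proj0_sub_const hw.continuous] at key
  rw [proj_eq_chainInv, ← hc]
  calc _ = ‖chainInv (params q θ₀ θ) (proj0 T k (iteratedDeriv q w)) -
          (proj0 T k w - const c)‖ := by
        congr 1; abel
    _ ≤ _ := key
    _ = _ := by ring

end projection

end Vh

/-! ### Space derivatives and time derivatives -/

lemma fwdDiff_iterate_sub (ε : ℝ) (n : ℕ) (f g : ℝ → ℝ) :
    (fwdDiff ε)^[n] (f - g) = (fwdDiff ε)^[n] f - (fwdDiff ε)^[n] g := by
  induction n generalizing f g with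
  | zero => rfl
  | succ n ih =>
    have e : fwdDiff ε (f - g) = fwdDiff ε f - fwdDiff ε g := by
      ext x
      simp only [fwdDiff, Pi.sub_apply]
      ring
    simp only [Function.iterate_succ_apply, e, ih]

/-- Mean value theorem for iterated differences. -/
lemma exists_fwdDiff_iterate_eq {n : ℕ} {f : ℝ → ℝ} (hf : ContDiff ℝ n f) {ε : ℝ} (hε : 0 < ε)
    (x : ℝ) : ∃ ξ ∈ Icc x (x + n * ε), (fwdDiff ε)^[n] f x = ε ^ n * iteratedDeriv n f ξ := by
  induction n generalizing f with
  | zero => exact ⟨x, by simp, by simp⟩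
  | succ n ih =>
    have hn : ContDiff ℝ n f := hf.of_le (by exact_mod_cast Nat.le_succ n)
    have hs : ContDiff ℝ n (fun y => f (y + ε)) := hn.comp (contDiff_id.add contDiff_const)
    obtain ⟨ξ, hξ, h⟩ := ih (f := fwdDiff ε f) (hs.sub hn)
    have e : iteratedDeriv n (fwdDiff ε f) ξ = iteratedDeriv n f (ξ + ε) - iteratedDeriv n f ξ := by
      have h1 : fwdDiff ε f = fun y => f (y + ε) - f y := rfl
      rw [h1, iteratedDeriv_fun_sub hs.contDiffAt hn.contDiffAt, iteratedDeriv_comp_add_const]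
    have hd : Differentiable ℝ (iteratedDeriv n f) :=
      hf.differentiable_iteratedDeriv n (by exact_mod_cast Nat.lt_succ_self n)
    obtain ⟨η, hη, h2⟩ := exists_deriv_eq_slope (iteratedDeriv n f) (by linarith : ξ < ξ + ε)
      hd.continuous.continuousOn hd.differentiableOn
    refine ⟨η, ⟨by linarith [hξ.1, hη.1], ?_⟩, ?_⟩
    · push_cast
      linarith [hξ.2, hη.2]
    · rw [Function.iterate_succ_apply, h, e, iteratedDeriv_succ, h2,
        add_sub_cancel_left, pow_succ, mul_assoc, mul_div_cancel₀ _ hε.ne']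

/-- A difference involves finitely many points x, so it commutes with the time derivative without
any joint regularity. -/
lemma hasDerivWithinAt_fwdDiff_iterate {s : Set ℝ} {t ε : ℝ} (n : ℕ) {f : ℝ → ℝ → ℝ} {g : ℝ → ℝ}
    (h : ∀ x, HasDerivWithinAt (fun r => f r x) (g x) s t) (x : ℝ) :
    HasDerivWithinAt (fun r => (fwdDiff ε)^[n] (f r) x) ((fwdDiff ε)^[n] g x) s t := by
  induction n generalizing f g with
  | zero => exact h x
  | succ n ih =>
    simp only [Function.iterate_succ_apply]
    exact ih (f := fun r => fwdDiff ε (f r)) (g := fwdDiff ε g) fun y => (h (y + ε)).sub (h y)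

/-- If `∂ₜ f = g` pointwise and `∂ₓⁿ g` is bounded, then `∂ₓⁿ f` is Lipschitz continuous in time. -/
lemma abs_iteratedDeriv_sub_le {n : ℕ} {f g : ℝ → ℝ → ℝ} {c d K : ℝ}
    (hfg : ∀ t ∈ Icc c d, ∀ x, HasDerivWithinAt (fun r => f r x) (g t x) (Icc c d) t)
    (hf : ∀ t ∈ Icc c d, ContDiff ℝ n (f t)) (hg : ∀ t ∈ Icc c d, ContDiff ℝ n (g t))
    (hK : ∀ t ∈ Icc c d, ∀ x, |iteratedDeriv n (g t) x| ≤ K) {s t : ℝ} (hs : s ∈ Icc c d)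
    (ht : t ∈ Icc c d) (x : ℝ) :
    |iteratedDeriv n (f t) x - iteratedDeriv n (f s) x| ≤ K * |t - s| := by
  have hF : ContDiff ℝ n (f t - f s) := (hf t ht).sub (hf s hs)
  have hFd : ∀ y, iteratedDeriv n (f t - f s) y =
      iteratedDeriv n (f t) y - iteratedDeriv n (f s) y :=
    fun y => iteratedDeriv_sub (hf t ht).contDiffAt (hf s hs).contDiffAt
  -- The n-th differences of f t - f s and of g are turned into derivatives by the mean value
  -- theorem, at points within nε of x. Letting ε tend to 0 gives the bound at x; below, this is
  -- done by contradiction with continuity.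
  have key : ∀ ε > 0, ∃ ξ ∈ Icc x (x + n * ε), |iteratedDeriv n (f t - f s) ξ| ≤ K * |t - s| := by
    intro ε hε
    obtain ⟨ξ, hξ, h⟩ := exists_fwdDiff_iterate_eq hF hε x
    refine ⟨ξ, hξ, ?_⟩
    have hb := Convex.norm_image_sub_le_of_norm_hasDerivWithin_le
      (f := fun r => (fwdDiff ε)^[n] (f r) x) (f' := fun r => (fwdDiff ε)^[n] (g r) x)
      (C := ε ^ n * K) (fun r hr => hasDerivWithinAt_fwdDiff_iterate n (hfg r hr) x)
      (fun r hr => by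
        obtain ⟨η, _, hη⟩ := exists_fwdDiff_iterate_eq (hg r hr) hε x
        rw [hη, norm_mul, norm_pow, Real.norm_eq_abs, Real.norm_eq_abs, abs_of_pos hε]
        exact mul_le_mul_of_nonneg_left (hK r hr η) (by positivity))
      (convex_Icc c d) hs ht
    have e : (fwdDiff ε)^[n] (f t) x - (fwdDiff ε)^[n] (f s) x =
        ε ^ n * iteratedDeriv n (f t - f s) ξ := by
      rw [← h, fwdDiff_iterate_sub]
      rfl
    rw [e, norm_mul, norm_pow, Real.norm_eq_abs, Real.norm_eq_abs, Real.norm_eq_abs,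
      abs_of_pos hε, mul_assoc] at hb
    exact le_of_mul_le_mul_left hb (by positivity)
  rw [← hFd]
  by_contra hcon
  push Not at hcon
  have hc : Continuous fun y => |iteratedDeriv n (f t - f s) y| :=
    (hF.continuous_iteratedDeriv' n).abs
  obtain ⟨δ, hδ, hball⟩ := Metric.mem_nhds_iff.mp (hc.continuousAt.eventually_const_lt hcon)
  obtain ⟨ξ, hξ, h⟩ := key (δ / (n + 1)) (by positivity)
  have hlt : (n : ℝ) * (δ / (n + 1)) < δ := by
    rw [← mul_div_assoc, div_lt_iff₀ (by positivity)]
    nlinarith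
  have hmem : ξ ∈ Metric.ball x δ := by
    rw [Metric.mem_ball, Real.dist_eq, abs_lt]
    constructor <;> linarith [hξ.1, hξ.2]
  exact absurd h (not_le.mpr (hball hmem))

/-- Taylor expansion in time when the last derivative is Lipschitz continuous. -/
lemma abs_sub_taylor_sum_le {c d K : ℝ} (hK0 : 0 ≤ K) (p : ℕ) (φ : ℕ → ℝ → ℝ)
    (hφ : ∀ i < p, ∀ t ∈ Icc c d, HasDerivWithinAt (φ i) (φ (i + 1) t) (Icc c d) t)
    (hK : ∀ s ∈ Icc c d, ∀ t ∈ Icc c d, |φ p t - φ p s| ≤ K * |t - s|) {t τ : ℝ} (hτ : 0 ≤ τ)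
    (ht : t ∈ Icc c d) (htτ : t + τ ∈ Icc c d) :
    |φ 0 (t + τ) - ∑ i ∈ Finset.range (p + 1), τ ^ i / i.factorial * φ i t| ≤ K * τ ^ (p + 1) := by
  induction p generalizing φ τ with
  | zero =>
    have := hK t ht _ htτ
    simpa [abs_of_nonneg hτ] using this
  | succ p ih =>
    have hsub : Icc t (t + τ) ⊆ Icc c d := Icc_subset_Icc ht.1 htτ.2
    -- The time derivative of the Taylor remainder is the remainder of order p for the shifted
    -- sequence, to which the induction hypothesis applies.
    have hder : ∀ r ∈ Icc t (t + τ), HasDerivWithinAt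
        (fun r => φ 0 r - ∑ i ∈ Finset.range (p + 1 + 1), (r - t) ^ i / i.factorial * φ i t)
        (φ 1 r - ∑ i ∈ Finset.range (p + 1), (r - t) ^ i / i.factorial * φ (i + 1) t)
        (Icc t (t + τ)) r := by
      intro r hr
      refine ((hφ 0 (by omega) r (hsub hr)).mono hsub).sub ?_
      have hterm : ∀ i, HasDerivAt (fun r => (r - t) ^ (i + 1) / (i + 1).factorial * φ (i + 1) t)
          ((r - t) ^ i / i.factorial * φ (i + 1) t) r := by
        intro i
        have h1 := ((((hasDerivAt_id r).sub_const t).pow (i + 1)).div_const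
          ((i + 1).factorial : ℝ)).mul_const (φ (i + 1) t)
        have : ((i + 1).factorial : ℝ) = (i + 1) * i.factorial := by
          rw [Nat.factorial_succ]; push_cast; ring
        have h0 : (i.factorial : ℝ) ≠ 0 := by exact_mod_cast i.factorial_ne_zero
        have h2 : (i + 1 : ℝ) ≠ 0 := by positivity
        have e : (r - t) ^ i / i.factorial * φ (i + 1) t = ((i + 1 : ℕ) : ℝ) *
            (id r - t) ^ (i + 1 - 1) * 1 / (i + 1).factorial * φ (i + 1) t := by
          rw [this]
          simp only [id, Nat.add_sub_cancel, mul_one]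
          push_cast
          field_simp
        rw [e]
        exact h1
      simp only [Finset.sum_range_succ' _ (p + 1)]
      have := (HasDerivAt.fun_sum (u := Finset.range (p + 1)) fun i _ => hterm i).add_const
        ((r - t) ^ 0 / (Nat.factorial 0 : ℝ) * φ 0 t)
      simp only [pow_zero] at this ⊢
      exact this.hasDerivWithinAt
    have hb := Convex.norm_image_sub_le_of_norm_hasDerivWithin_le (C := K * τ ^ (p + 1)) hder
      (fun r hr => by
        have := ih (fun i => φ (i + 1)) (fun i hi => hφ (i + 1) (by omega)) hK (τ := r - t)
          (by linarith [hr.1]) (by rw [add_sub_cancel]; exact hsub hr)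
        rw [add_sub_cancel] at this
        refine this.trans ?_
        have h1 : r - t ≤ τ := by linarith [hr.2]
        have h2 : 0 ≤ r - t := by linarith [hr.1]
        gcongr)
      (convex_Icc _ _) (left_mem_Icc.mpr (by linarith)) (right_mem_Icc.mpr (by linarith))
    have e0 : φ 0 t - ∑ i ∈ Finset.range (p + 1 + 1), (t - t) ^ i / i.factorial * φ i t = 0 := by
      rw [Finset.sum_range_succ']
      simp
    rw [e0, sub_zero, Real.norm_eq_abs, Real.norm_eq_abs, add_sub_cancel_left,
      abs_of_nonneg hτ] at hb
    refine hb.trans_eq ?_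
    ring

/-! ### Bounds for smooth solutions -/

/-- Sobolev embedding in one dimension. -/
lemma abs_le_of_integral_sq_le {a b M : ℝ} (hab : a < b) {f f' : ℝ → ℝ}
    (hf : ∀ x, HasDerivAt f (f' x) x) (hf' : Continuous f') (hper : Function.Periodic f (b - a))
    (h0 : ∫ x in a..b, f x ^ 2 ≤ M ^ 2) (h1 : ∫ x in a..b, f' x ^ 2 ≤ M ^ 2) (x : ℝ) :
    |f x| ≤ 1 + M ^ 2 / (b - a) + (M ^ 2 + (b - a)) := by
  have hfc : Continuous f := continuous_iff_continuousAt.mpr fun x => (hf x).continuousAt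
  have hpos := sub_pos.mpr hab
  obtain ⟨x', hx', hxx'⟩ := hper.exists_mem_Ico hpos x a
  rw [add_sub_cancel] at hx'
  rw [hxx']
  have hx : x' ∈ Icc a b := Ico_subset_Icc_self hx'
  -- The minimum of f² is at most its mean value, which bounds f at y; the integral of |f'| ≤ f'² +
  -- 1 bounds the variation of f from y.
  obtain ⟨y, hy, hmin⟩ := isCompact_Icc.exists_isMinOn (nonempty_Icc.mpr hab.le)
    (f := fun x => f x ^ 2) (by fun_prop : ContinuousOn _ (Icc a b))
  have h2 : f y ^ 2 ≤ M ^ 2 / (b - a) := by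
    rw [le_div_iff₀ hpos]
    have := intervalIntegral.integral_mono_on (μ := MeasureTheory.volume) hab.le
      (continuous_const.intervalIntegrable a b)
      (Continuous.intervalIntegrable (by fun_prop : Continuous fun x => f x ^ 2) a b)
      (fun x hx => hmin hx)
    rw [intervalIntegral.integral_const, smul_eq_mul] at this
    linarith
  have h3 : |f y| ≤ 1 + M ^ 2 / (b - a) := by
    rw [← sq_abs] at h2
    nlinarith [sq_nonneg (|f y| - 1), abs_nonneg (f y)]
  have h4 : ∀ c d, a ≤ c → c ≤ d → d ≤ b → |f d - f c| ≤ M ^ 2 + (b - a) := by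
    intro c d hac hcd hdb
    rw [← intervalIntegral.integral_eq_sub_of_hasDerivAt (fun x _ => hf x)
      (hf'.intervalIntegrable _ _)]
    calc |∫ x in c..d, f' x| ≤ ∫ x in c..d, |f' x| :=
          intervalIntegral.abs_integral_le_integral_abs hcd
      _ ≤ ∫ x in a..b, |f' x| := intervalIntegral.integral_mono_interval hac hcd hdb
          (Filter.Eventually.of_forall fun _ => abs_nonneg _)
          (Continuous.intervalIntegrable (by fun_prop) _ _)
      _ ≤ ∫ x in a..b, (f' x ^ 2 + 1) := by
          refine intervalIntegral.integral_mono_on hab.le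
            (Continuous.intervalIntegrable (by fun_prop) _ _)
            (Continuous.intervalIntegrable (by fun_prop) _ _) fun x _ => ?_
          rw [← sq_abs (f' x)]
          nlinarith [sq_nonneg (|f' x| - 1), abs_nonneg (f' x)]
      _ = (∫ x in a..b, f' x ^ 2) + (b - a) := by
          rw [intervalIntegral.integral_add (Continuous.intervalIntegrable (by fun_prop) _ _)
            (Continuous.intervalIntegrable (by fun_prop) _ _)]
          simp
      _ ≤ _ := by linarith
  have h5 : |f x' - f y| ≤ M ^ 2 + (b - a) := by
    rcases le_total y x' with h | h
    · exact h4 y x' hy.1 h hx.2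
    · rw [abs_sub_comm]
      exact h4 x' y hx.1 h hy.2
  have h6 : |f x'| ≤ |f y| + |f x' - f y| := by
    calc |f x'| = |f y + (f x' - f y)| := by congr 1; ring
      _ ≤ _ := abs_add_le _ _
  linarith

/-- The embedding costs one derivative. From H^m with m = k + 1 + q(p + 2) there remain (k + q) +
q(p + 1) bounded derivatives, so that L^i u keeps k + q of them for all i ≤ p + 1. -/
lemma boundedSmooth_of_sobolevNorm_le {a b M : ℝ} (hab : a < b) {n : ℕ} {f : ℝ → ℝ}
    (hf : ContDiff ℝ (n + 1 : ℕ) f) (hper : Function.Periodic f (b - a))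
    (hM : sobolevNorm a b (n + 1) f ≤ M) :
    BoundedSmooth a b n (1 + M ^ 2 / (b - a) + (M ^ 2 + (b - a))) f := by
  have hnn : ∀ i, 0 ≤ ∫ x in a..b, iteratedDeriv i f x ^ 2 := fun i =>
    intervalIntegral.integral_nonneg hab.le fun _ _ => sq_nonneg _
  have hint : ∀ i ≤ n + 1, ∫ x in a..b, iteratedDeriv i f x ^ 2 ≤ M ^ 2 := by
    intro i hi
    rw [sobolevNorm] at hM
    have h1 := (Real.sqrt_le_iff.mp hM).2
    refine le_trans ?_ h1
    exact Finset.single_le_sum (f := fun i => ∫ x in a..b, iteratedDeriv i f x ^ 2)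
      (fun i _ => hnn i) (Finset.mem_range.mpr (by omega))
  refine ⟨hf.of_le (by exact_mod_cast Nat.le_succ n), hper, fun i hi x => ?_⟩
  refine abs_le_of_integral_sq_le hab (f' := iteratedDeriv (i + 1) f) (fun y => ?_) ?_
    (periodic_iteratedDeriv hper i) (hint i (by omega)) (hint (i + 1) (by omega)) x
  · rw [iteratedDeriv_succ]
    exact (hf.differentiable_iteratedDeriv i
      (by exact_mod_cast (by omega : i < n + 1))).differentiableAt.hasDerivAt
  · exact hf.continuous_iteratedDeriv (i + 1) (by exact_mod_cast (by omega : i + 1 ≤ n + 1))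

lemma Lop_iterate (β : ℝ) (q i : ℕ) (w : ℝ → ℝ) :
    (Lop β q)^[i] w = fun x => β ^ i * iteratedDeriv (q * i) w x := by
  induction i with
  | zero => simp
  | succ i ih =>
    rw [Function.iterate_succ_apply', ih]
    ext x
    rw [Lop, iteratedDeriv_const_mul_field, iteratedDeriv_iteratedDeriv, Nat.mul_succ,
      add_comm (q * i) q]
    ring

lemma BoundedSmooth.Lop_iterate {a b W β : ℝ} {n m q i p : ℕ} {f : ℝ → ℝ}
    (hf : BoundedSmooth a b n W f) (him : m + q * i ≤ n) (hip : i ≤ p + 1) :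
    BoundedSmooth a b m ((1 + |β|) ^ (p + 1) * W) ((Lop β q)^[i] f) := by
  have h := hf.iteratedDeriv him
  rw [LDG.Lop_iterate]
  refine ⟨contDiff_const.mul h.contDiff, fun x => by simp only [h.periodic x], fun l hl x => ?_⟩
  rw [iteratedDeriv_const_mul_field, abs_mul, abs_pow]
  have h1 : |β| ^ i ≤ (1 + |β|) ^ (p + 1) :=
    calc |β| ^ i ≤ (1 + |β|) ^ i := by gcongr; linarith
      _ ≤ (1 + |β|) ^ (p + 1) := pow_le_pow_right₀ (by linarith [abs_nonneg β]) hip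
  exact mul_le_mul h1 (h.bound l hl x) (abs_nonneg _) (by positivity)

/-! ### Taylor expansion of solutions in time. -/

namespace IsSmoothSolution

variable {a b β tEnd W : ℝ} {q p m : ℕ} {u : ℝ → ℝ → ℝ}

/-- Taylor expansion of a solution in time. -/
lemma abs_sub_taylor_le (hu : IsSmoothSolution a b β q p m tEnd u)
    (hW : ∀ t ∈ Icc 0 tEnd, ∀ x, |(Lop β q)^[p + 1] (u t) x| ≤ W) {t τ : ℝ} (hτ : 0 ≤ τ)
    (ht : t ∈ Icc 0 tEnd) (htτ : t + τ ∈ Icc 0 tEnd) (x : ℝ) :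
    |u (t + τ) x - ∑ i ∈ Finset.range (p + 1), τ ^ i / i.factorial * (Lop β q)^[i] (u t) x| ≤
      W * τ ^ (p + 1) :=
  abs_sub_taylor_sum_le ((abs_nonneg _).trans (hW t ht x)) p (fun i r => (Lop β q)^[i] (u r) x)
    (fun i hi r hr => hu.time_deriv i hi.le r hr x)
    (fun _ hs _ ht => Convex.norm_image_sub_le_of_norm_hasDerivWithin_le
      (fun r hr => hu.time_deriv p le_rfl r hr x) (fun r hr => hW r hr x) (convex_Icc _ _) hs ht)
    hτ ht htτ

/-- Mixed derivatives are not assumed to commute. If β ≠ 0, then ∂ₓ^q L^i u = β⁻¹ L^{i+1} u, whose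
time derivative is known as i + 1 ≤ p. If β = 0, then u does not depend on time. -/
lemma hasDerivWithinAt_iteratedDeriv (hu : IsSmoothSolution a b β q p m tEnd u) {i : ℕ} (hi : i < p)
    {t : ℝ} (ht : t ∈ Icc 0 tEnd) (x : ℝ) :
    HasDerivWithinAt (fun r => iteratedDeriv q ((Lop β q)^[i] (u r)) x)
      (iteratedDeriv q ((Lop β q)^[i + 1] (u t)) x) (Icc 0 tEnd) t := by
  rcases eq_or_ne β 0 with rfl | hβ
  · have hconst : ∀ r ∈ Icc 0 tEnd, u r = u t := by
      intro r hr
      ext y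
      have := Convex.norm_image_sub_le_of_norm_hasDerivWithin_le (C := 0)
        (fun r hr => hu.time_deriv 0 (Nat.zero_le _) r hr y)
        (fun r _ => by simp [Lop]) (convex_Icc _ _) ht hr
      simp only [Function.iterate_zero, id, zero_mul] at this
      exact sub_eq_zero.mp (norm_le_zero_iff.mp this)
    have h0 : (Lop 0 q)^[i + 1] (u t) = fun _ => 0 := by
      rw [Function.iterate_succ_apply']
      ext y
      simp [Lop]
    rw [h0]
    have hz : iteratedDeriv q (fun _ : ℝ => (0 : ℝ)) x = 0 := by
      rw [iteratedDeriv_const]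
      split_ifs <;> rfl
    rw [hz]
    exact (hasDerivWithinAt_const t (Icc 0 tEnd)
      (iteratedDeriv q ((Lop 0 q)^[i] (u t)) x)).congr_of_mem
      (fun r hr => by rw [hconst r hr]) ht
  · have e : ∀ (j : ℕ) (r : ℝ), iteratedDeriv q ((Lop β q)^[j] (u r)) x =
        β⁻¹ * (Lop β q)^[j + 1] (u r) x := by
      intro j r
      rw [Function.iterate_succ_apply', Lop, inv_mul_cancel_left₀ hβ]
    simp only [e]
    exact (hu.time_deriv (i + 1) (by omega) t ht x).const_mul β⁻¹

/-- Taylor expansion in time of the `q`-th space derivative of a solution. -/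
lemma abs_iteratedDeriv_sub_taylor_le (hu : IsSmoothSolution a b β q p m tEnd u)
    (hsm : ∀ t ∈ Icc 0 tEnd, ∀ i ≤ p + 1, BoundedSmooth a b q W ((Lop β q)^[i] (u t))) {t τ : ℝ}
    (hτ : 0 ≤ τ) (ht : t ∈ Icc 0 tEnd) (htτ : t + τ ∈ Icc 0 tEnd) (x : ℝ) :
    |iteratedDeriv q (u (t + τ)) x - ∑ i ∈ Finset.range (p + 1), τ ^ i / i.factorial *
      iteratedDeriv q ((Lop β q)^[i] (u t)) x| ≤ W * τ ^ (p + 1) :=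
  abs_sub_taylor_sum_le (hsm t ht 0 (Nat.zero_le _)).nonneg p
    (fun i r => iteratedDeriv q ((Lop β q)^[i] (u r)) x)
    (fun i hi r hr => hu.hasDerivWithinAt_iteratedDeriv hi hr x)
    -- For i = p the argument via β⁻¹ L^{p+1} u would need one more time derivative than is assumed.
    -- Lipschitz continuity of ∂ₓ^q L^p u suffices and follows from the difference argument.
    (fun s hs r hr => abs_iteratedDeriv_sub_le (f := fun r => (Lop β q)^[p] (u r))
      (g := fun r => (Lop β q)^[p + 1] (u r)) (hu.time_deriv p le_rfl)
      (fun r hr => (hsm r hr p (by omega)).contDiff)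
      (fun r hr => (hsm r hr (p + 1) le_rfl).contDiff)
      (fun r hr => (hsm r hr (p + 1) le_rfl).bound q le_rfl) hs hr x)
    hτ ht htτ

end IsSmoothSolution

/-! ### Time stepping -/

/-- The step of a Runge-Kutta method of order `p`, compared with the Taylor polynomial built from
approximations `x i` of `A^i x 0`. -/
lemma norm_rungeKutta_sub_taylor_le {V : Type*} [NormedAddCommGroup V] [NormedSpace ℝ V]
    (A : Module.End ℝ V) {τ ε B : ℝ} (hτ0 : 0 ≤ τ) (hτ1 : τ ≤ 1) (hε : 0 ≤ ε) (hB : 0 ≤ B)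
    (hA : ∀ v, ‖(τ • A) v‖ ≤ ‖v‖) {s p : ℕ} (hps : p ≤ s) {α : ℕ → ℝ}
    (hα : ∀ i ≤ p, α i = 1 / (i.factorial : ℝ)) (x y : ℕ → V) (hxy : ∀ i ≤ p, A (x i) = y (i + 1))
    (hyx : ∀ i, 1 ≤ i → i ≤ p → ‖y i - x i‖ ≤ ε) (hy : ‖y (p + 1)‖ ≤ B) :
    ‖∑ i ∈ Finset.range (s + 1), α i • ((τ • A) ^ i) (x 0) -
      ∑ i ∈ Finset.range (p + 1), (τ ^ i / i.factorial) • x i‖ ≤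
      (∑ i ∈ Finset.range (s + 1), |α i|) * (p * (τ * ε) + τ ^ (p + 1) * B) := by
  have hstep : ∀ i ≤ p, ((τ • A) ^ (i + 1)) (x 0) =
      (τ • A) (((τ • A) ^ i) (x 0) - τ ^ i • x i) + τ ^ (i + 1) • y (i + 1) := by
    intro i hi
    rw [pow_succ', Module.End.mul_apply, map_sub, map_smul,
      LinearMap.smul_apply τ A (x i), hxy i hi, smul_smul, ← pow_succ]
    abel
  -- Each application of τ A carries the old error without growth and adds τ^{i+1} (y_{i+1} -
  -- x_{i+1}), where τ^{i+1} ≤ τ because τ ≤ 1.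
  have hlow : ∀ i ≤ p, ‖((τ • A) ^ i) (x 0) - τ ^ i • x i‖ ≤ i * (τ * ε) := by
    intro i
    induction i with
    | zero => intro _; simp
    | succ i ih =>
      intro hi
      have e : ((τ • A) ^ (i + 1)) (x 0) - τ ^ (i + 1) • x (i + 1) =
          (τ • A) (((τ • A) ^ i) (x 0) - τ ^ i • x i) + τ ^ (i + 1) • (y (i + 1) - x (i + 1)) := by
        rw [hstep i (by omega), smul_sub]
        abel
      rw [e]
      refine (norm_add_le _ _).trans ?_
      have h1 := (hA _).trans (ih (by omega))
      have h2 : ‖τ ^ (i + 1) • (y (i + 1) - x (i + 1))‖ ≤ τ * ε := by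
        rw [norm_smul, norm_pow, Real.norm_eq_abs, abs_of_nonneg hτ0]
        refine mul_le_mul ?_ (hyx _ (by omega) hi) (norm_nonneg _) hτ0
        exact pow_le_of_le_one hτ0 hτ1 (by omega)
      push_cast
      linarith
  -- Powers beyond p are small by themselves: the power p + 1 already carries τ^{p+1}, and further
  -- factors do not increase the norm.
  have hhigh : ∀ j, ‖((τ • A) ^ (p + 1 + j)) (x 0)‖ ≤ p * (τ * ε) + τ ^ (p + 1) * B := by
    intro j
    induction j with
    | zero =>
      rw [add_zero, hstep p le_rfl]
      refine (norm_add_le _ _).trans (add_le_add ((hA _).trans (hlow p le_rfl)) ?_)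
      rw [norm_smul, norm_pow, Real.norm_eq_abs, abs_of_nonneg hτ0]
      gcongr
    | succ j ih =>
      rw [← add_assoc, pow_succ', Module.End.mul_apply]
      exact (hA _).trans ih
  have hsum : ∑ i ∈ Finset.range (p + 1), (τ ^ i / i.factorial) • x i =
      ∑ i ∈ Finset.range (s + 1), α i • (if i ≤ p then τ ^ i • x i else 0) := by
    rw [← Finset.sum_subset (Finset.range_mono (by omega : p + 1 ≤ s + 1))]
    · refine Finset.sum_congr rfl fun i hi => ?_
      have hi' : i ≤ p := by simpa [Nat.lt_succ_iff] using hi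
      rw [if_pos hi', hα i hi', smul_smul]
      congr 1
      ring
    · intro i _ hi
      rw [if_neg (by simpa [Nat.lt_succ_iff] using hi), smul_zero]
  rw [hsum, ← Finset.sum_sub_distrib, Finset.sum_mul]
  refine norm_sum_le_of_le _ fun i _ => ?_
  rw [← smul_sub, norm_smul, Real.norm_eq_abs]
  refine mul_le_mul_of_nonneg_left ?_ (abs_nonneg _)
  split_ifs with hi
  · refine (hlow i hi).trans ?_
    have h1 : (i : ℝ) ≤ p := by exact_mod_cast hi
    have h2 : (i : ℝ) * (τ * ε) ≤ p * (τ * ε) := by gcongr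
    have h3 : 0 ≤ τ ^ (p + 1) * B := by positivity
    linarith
  · obtain ⟨j, rfl⟩ := Nat.exists_eq_add_of_le (by omega : p + 1 ≤ i)
    rw [sub_zero]
    exact hhigh j

lemma sigma_nonneg {μ t : ℝ} (hμ : 0 ≤ μ) (ht : 0 ≤ t) : 0 ≤ sigma μ t := by
  rw [sigma]
  split_ifs with h
  · exact ht
  · refine div_nonneg ?_ hμ
    linarith [Real.one_le_exp (mul_nonneg hμ ht)]

/-- σ solves σ' = μσ + 1, and an Euler step stays below the exact solution because 1 + μτ ≤ e^{μτ}.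
-/
lemma sigma_succ_le {μ t τ : ℝ} (hμ : 0 ≤ μ) :
    (1 + μ * τ) * sigma μ t + τ ≤ sigma μ (t + τ) := by
  simp only [sigma]
  split_ifs with h
  · simp [h]
  · have hpos : 0 < μ := lt_of_le_of_ne hμ (Ne.symm h)
    rw [le_div_iff₀ hpos]
    have e : ((1 + μ * τ) * ((Real.exp (μ * t) - 1) / μ) + τ) * μ =
        (1 + μ * τ) * Real.exp (μ * t) - 1 := by
      field_simp
      ring
    rw [e, mul_add, Real.exp_add]
    have h1 := Real.add_one_le_exp (μ * τ)
    nlinarith [Real.exp_pos (μ * t)]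

/-- Discrete Gronwall inequality. -/
lemma le_sigma_mul {e : ℕ → ℝ} {μ τ δ tEnd : ℝ} (hμ : 0 ≤ μ) (hτ : 0 ≤ τ) (hδ : 0 ≤ δ)
    (h0 : e 0 ≤ 0)
    (hstep : ∀ n : ℕ, (n + 1) * τ ≤ tEnd → e (n + 1) ≤ (1 + μ * τ) * e n + τ * δ) (n : ℕ)
    (hn : n * τ ≤ tEnd) : e n ≤ sigma μ (n * τ) * δ := by
  induction n with
  | zero =>
    refine h0.trans (mul_nonneg (sigma_nonneg hμ ?_) hδ)
    simp
  | succ n ih =>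
    push_cast at hn ⊢
    have h1 := ih (by nlinarith)
    have h2 := sigma_succ_le (t := n * τ) (τ := τ) hμ
    have h3 : 0 ≤ 1 + μ * τ := by positivity
    calc e (n + 1) ≤ (1 + μ * τ) * e n + τ * δ := hstep n hn
      _ ≤ (1 + μ * τ) * (sigma μ (n * τ) * δ) + τ * δ := by gcongr
      _ = ((1 + μ * τ) * sigma μ (n * τ) + τ) * δ := by ring
      _ ≤ sigma μ (n * τ + τ) * δ := by gcongr
      _ = _ := by rw [add_mul, one_mul]

/-! ### Stability of the time step and of Π. -/

namespace Vh

variable {a b : ℝ} {T : Mesh a b} {k : ℕ}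

lemma norm_apply_le_opNorm (A : Module.End ℝ (Vh T k)) (v : Vh T k) : ‖A v‖ ≤ opNorm A * ‖v‖ :=
  (LinearMap.toContinuousLinearMap A).le_opNorm v

lemma R_apply (s : ℕ) (α : ℕ → ℝ) (τ : ℝ) (A : Module.End ℝ (Vh T k)) (v : Vh T k) :
    R s α τ A v = ∑ i ∈ Finset.range (s + 1), α i • ((τ • A) ^ i) v := by
  simp [R, LinearMap.sum_apply]

/-- Stability of `Π`, applied to the difference of a function and a linear combination. -/
lemma exists_proj_sub_sum_norm_le (a b : ℝ) (k : ℕ) {q : ℕ} {θ₀ : ℝ} {θ : Fin (q / 2) → ℝ}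
    (hq : 1 ≤ q) (hθ₀ : Odd q → θ₀ ≠ 1 / 2) (hθ : ∀ i, θ i ≠ 1 / 2) : ∃ C : ℝ, 0 ≤ C ∧
    ∀ (T : Mesh a b) (n : ℕ) (f : ℝ → ℝ) (g : ℕ → ℝ → ℝ) (c : ℕ → ℝ) (W E : ℝ),
    BoundedSmooth a b q W f → (∀ i ∈ Finset.range n, BoundedSmooth a b q W (g i)) →
    (∀ x, |f x - ∑ i ∈ Finset.range n, c i * g i x| ≤ E) →
    (∀ x, |iteratedDeriv q f x - ∑ i ∈ Finset.range n, c i * iteratedDeriv q (g i) x| ≤ E) →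
    ‖proj T k q θ₀ θ f - ∑ i ∈ Finset.range n, c i • proj T k q θ₀ θ (g i)‖ ≤ C * E := by
  obtain ⟨C, hC, h⟩ := exists_norm_le_chain a b k (params_ne_half hθ₀ hθ)
    (params_ne_nil (q := q) (θ₀ := θ₀) (θ := θ) hq)
  obtain ⟨S, hS, hproj⟩ := exists_proj0_norm_le a b k
  refine ⟨C * (S + |b - a|), by positivity, fun T n f g c W E hf hg hE hEq => ?_⟩
  have hcont : ∀ {w : ℝ → ℝ}, BoundedSmooth a b q W w → Continuous (iteratedDeriv q w) :=
    fun hw => (hw.iteratedDeriv (i := q) (m := 0) (by omega)).continuous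
  -- The norm is controlled by the chain and the mean value. Applied to Π w these give Π₀ ∂ₓ^q w and
  -- the mean of w, both linear in w, so linearity of Π itself is not needed.
  refine (h T _).trans ?_
  rw [mul_assoc]
  refine mul_le_mul_of_nonneg_left ?_ hC
  rw [add_mul]
  refine add_le_add ?_ ?_
  · have e : chain T k (params q θ₀ θ)
        (proj T k q θ₀ θ f - ∑ i ∈ Finset.range n, c i • proj T k q θ₀ θ (g i)) =
        proj0 T k (fun x => iteratedDeriv q f x -
          ∑ i ∈ Finset.range n, c i * iteratedDeriv q (g i) x) := by
      rw [proj0_sub_sum _ c (hcont hf) (fun i hi => hcont (hg i hi)), map_sub, map_sum,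
        chain_proj hq hθ₀ hθ hf]
      congr 1
      refine Finset.sum_congr rfl fun i hi => ?_
      rw [map_smul, chain_proj hq hθ₀ hθ (hg i hi)]
    rw [e]
    exact hproj T _ E ((hcont hf).sub (continuous_finsetSum _ fun i hi =>
      continuous_const.mul (hcont (hg i hi)))) hEq
  · have hi : ∀ i ∈ Finset.range n, IntervalIntegrable (fun x => c i * g i x)
        MeasureTheory.volume a b := fun i hi =>
      (continuous_const.mul (hg i hi).continuous).intervalIntegrable _ _
    have hs : Continuous fun x => ∑ i ∈ Finset.range n, c i * g i x :=
      continuous_finsetSum _ fun i hi => continuous_const.mul (hg i hi).continuous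
    have e : ⟪proj T k q θ₀ θ f - ∑ i ∈ Finset.range n, c i • proj T k q θ₀ θ (g i), const 1⟫_ℝ =
        ∫ x in a..b, (f x - ∑ i ∈ Finset.range n, c i * g i x) := by
      rw [intervalIntegral.integral_sub (hf.continuous.intervalIntegrable _ _)
        (hs.intervalIntegrable _ _),
        intervalIntegral.integral_finsetSum hi, inner_sub_left, inner_proj_const hq hθ₀ hθ hf,
        sum_inner]
      congr 1
      refine Finset.sum_congr rfl fun i hi => ?_
      rw [real_inner_smul_left, inner_proj_const hq hθ₀ hθ (hg i hi),
        intervalIntegral.integral_const_mul]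
    rw [e, mul_comm]
    exact intervalIntegral.norm_integral_le_of_norm_le_const
      (f := fun x => f x - ∑ i ∈ Finset.range n, c i * g i x) (fun x _ => hE x)

end Vh

end LDG
end

/-! ### The error estimate. -/

open LDG LDG.Vh in
theorem mainTheorem2
    -- the domain, the equation and the flux parameters
    (a b : ℝ) (hab : a < b) (q : ℕ) (hq : 1 ≤ q) (β : ℝ)
    (θ₀ : ℝ) (θ : Fin (q / 2) → ℝ)
    (hθ₀ : Odd q → θ₀ ≠ 1 / 2) (hθ : ∀ i, θ i ≠ 1 / 2)
    -- the polynomial degree and the Runge-Kutta method of linear order `p`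
    (k : ℕ) (s p : ℕ) (hp : 1 ≤ p) (hps : p ≤ s) (α : ℕ → ℝ)
    (hα : ∀ i ≤ p, α i = 1 / (i.factorial : ℝ))
    -- the quasi-uniformity constant and the bound for the Sobolev norm of the solution
    (ρ M : ℝ) :
    ∃ C : ℝ, 0 < C ∧
      ∀ (tEnd : ℝ) (u : ℝ → ℝ → ℝ),
        LDG.IsSmoothSolution a b β q p (k + 1 + q * (p + 2)) tEnd u →
        (∀ t ∈ Set.Icc 0 tEnd, LDG.sobolevNorm a b (k + 1 + q * (p + 2)) (u t) ≤ M) →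
      ∀ T : LDG.Mesh a b, T.QuasiUniform ρ →
      ∀ (τ lam μh : ℝ), 0 < τ → τ ≤ 1 → lam < 1 → 0 ≤ μh →
        τ * LDG.Vh.opNorm (LDG.Vh.Lh T k q β θ₀ θ) ≤ lam →
        LDG.Vh.opNorm (LDG.Vh.R s α τ (LDG.Vh.Lh T k q β θ₀ θ)) ≤ 1 + μh * τ →
      ∀ uh : ℕ → LDG.Vh T k,
        uh 0 = LDG.Vh.proj T k q θ₀ θ (u 0) →
        (∀ n, uh (n + 1) = LDG.Vh.R s α τ (LDG.Vh.Lh T k q β θ₀ θ) (uh n)) →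
      ∀ n : ℕ, n * τ ≤ tEnd →
        LDG.Vh.l2Error (u (n * τ)) (uh n) ≤
          C * (LDG.sigma μh (n * τ) + 1) * (T.h ^ (k + 1) + τ ^ p) := by
  obtain ⟨C₁, hC₁, hproj⟩ := exists_proj_error (q := q) (θ₀ := θ₀) (θ := θ) a b k hq hθ₀ hθ
  obtain ⟨C₂, hC₂, hstab⟩ := exists_proj_sub_sum_norm_le (q := q) (θ₀ := θ₀) (θ := θ) a b k
    hq hθ₀ hθ
  obtain ⟨C₃, hC₃, hproj0⟩ := exists_proj0_error k
  obtain ⟨S, hS, hnorm⟩ := exists_proj0_norm_le a b k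
  have hbapos := sub_pos.mpr hab
  set W₀ := 1 + M ^ 2 / (b - a) + (M ^ 2 + (b - a)) with hW₀
  have hW₀pos : 0 ≤ W₀ := by positivity
  set W := (1 + |β|) ^ (p + 1) * W₀ with hW
  have hWpos : 0 ≤ W := by positivity
  set A := ∑ i ∈ Finset.range (s + 1), |α i| with hA
  have hApos : 0 ≤ A := Finset.sum_nonneg fun i _ => abs_nonneg _
  -- Local error per unit time: the terms with A come from the Runge-Kutta defect, C₂ * W from the
  -- Taylor remainder in time.
  set Q := A * (p * (C₁ * W) + S * W) + C₂ * W with hQ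
  have hQpos : 0 ≤ Q := by positivity
  refine ⟨2 * (√(b - a) * (C₃ * W) + C₁ * W + Q) + 1, by positivity, ?_⟩
  intro tEnd u hu hM T _ τ lam μh hτ hτ1 hlam hμ hτL hR uh huh0 huh n hn
  -- bounds for the solution and its time derivatives
  have hsm : ∀ t ∈ Icc 0 tEnd, BoundedSmooth a b (k + q * (p + 2)) W₀ (u t) := fun t ht =>
    boundedSmooth_of_sobolevNorm_le hab
      (by rw [show k + q * (p + 2) + 1 = k + 1 + q * (p + 2) by ring]; exact hu.contDiff t ht)
      (hu.periodic t ht)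
      (by rw [show k + q * (p + 2) + 1 = k + 1 + q * (p + 2) by ring]; exact hM t ht)
  have hU : ∀ t ∈ Icc 0 tEnd, ∀ i ≤ p + 1, ∀ m ≤ k + q,
      BoundedSmooth a b m W ((Lop β q)^[i] (u t)) := fun t ht i hi m hm =>
    (hsm t ht).Lop_iterate (by nlinarith) hi
  have hu0 : ∀ t ∈ Icc 0 tEnd, ∀ m ≤ k + q, BoundedSmooth a b m W (u t) := fun t ht m hm =>
    hU t ht 0 (Nat.zero_le _) m hm
  have hmem : ∀ l : ℕ, l * τ ≤ tEnd → (l : ℝ) * τ ∈ Icc 0 tEnd := fun l hl => ⟨by positivity, hl⟩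
  have hh : 0 ≤ T.h ^ (k + 1) := pow_nonneg T.h_pos.le _
  have hτp : 0 ≤ τ ^ p := by positivity
  -- one step of the scheme
  have hstep : ∀ l : ℕ, (l + 1) * τ ≤ tEnd →
      ‖uh (l + 1) - proj T k q θ₀ θ (u ((l + 1 : ℕ) * τ))‖ ≤
      (1 + μh * τ) * ‖uh l - proj T k q θ₀ θ (u (l * τ))‖ + τ * (Q * (T.h ^ (k + 1) + τ ^ p)) := by
    intro l hl
    have hl0 : (l : ℝ) * τ ∈ Icc 0 tEnd := hmem l (by nlinarith)
    have hl1 : (l : ℝ) * τ + τ ∈ Icc 0 tEnd := by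
      rw [← add_one_mul]
      exact ⟨by positivity, hl⟩
    have ecast : ((l + 1 : ℕ) : ℝ) * τ = l * τ + τ := by push_cast; ring
    rw [huh, ecast]
    have hRK := norm_rungeKutta_sub_taylor_le (Lh T k q β θ₀ θ) hτ.le hτ1
      (ε := C₁ * (W * T.h ^ (k + 1))) (B := S * W) (by positivity) (by positivity)
      (fun v => by
        rw [LinearMap.smul_apply, norm_smul, Real.norm_eq_abs, abs_of_pos hτ]
        calc τ * ‖Lh T k q β θ₀ θ v‖ ≤ τ * (opNorm (Lh T k q β θ₀ θ) * ‖v‖) := by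
              gcongr
              exact norm_apply_le_opNorm _ v
          _ = (τ * opNorm (Lh T k q β θ₀ θ)) * ‖v‖ := by ring
          _ ≤ 1 * ‖v‖ := by
              gcongr
              linarith
          _ = ‖v‖ := one_mul _)
      hps hα (fun i => proj T k q θ₀ θ ((Lop β q)^[i] (u (l * τ))))
      (fun i => proj0 T k ((Lop β q)^[i] (u (l * τ))))
      (fun i hi => by
        rw [Function.iterate_succ_apply']
        exact Lh_proj hq hθ₀ hθ (hU _ hl0 i (by omega) q (by omega)))
      (fun i _ hi => by
        rw [norm_sub_rev]
        exact hproj T _ W (hU _ hl0 i (by omega) (k + q) le_rfl))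
      (hnorm T _ W (hU _ hl0 (p + 1) le_rfl 0 (by omega)).continuous
        (fun x => by simpa using (hU _ hl0 (p + 1) le_rfl 0 (by omega)).bound 0 le_rfl x))
    have hTay := hstab T (p + 1) (u (l * τ + τ)) (fun i => (Lop β q)^[i] (u (l * τ)))
      (fun i => τ ^ i / i.factorial) W (W * τ ^ (p + 1)) (hu0 _ hl1 q (by omega))
      (fun i hi => hU _ hl0 i (by have := Finset.mem_range.mp hi; omega) q (by omega))
      (fun x => hu.abs_sub_taylor_le
        (fun t ht x => by simpa using (hU t ht (p + 1) le_rfl 0 (by omega)).bound 0 le_rfl x)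
        hτ.le hl0 hl1 x)
      (fun x => hu.abs_iteratedDeriv_sub_taylor_le
        (fun t ht i hi => hU t ht i hi q (by omega)) hτ.le hl0 hl1 x)
    rw [← R_apply] at hRK
    simp only [Function.iterate_zero, id] at hRK
    -- Propagated error, plus the defect of the scheme against the projected Taylor polynomial,
    -- minus the projected Taylor remainder.
    have hsplit : R s α τ (Lh T k q β θ₀ θ) (uh l) - proj T k q θ₀ θ (u (l * τ + τ)) =
        R s α τ (Lh T k q β θ₀ θ) (uh l - proj T k q θ₀ θ (u (l * τ))) +
        (R s α τ (Lh T k q β θ₀ θ) (proj T k q θ₀ θ (u (l * τ))) -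
          ∑ i ∈ Finset.range (p + 1), (τ ^ i / (i.factorial : ℝ)) •
            proj T k q θ₀ θ ((Lop β q)^[i] (u (l * τ)))) -
        (proj T k q θ₀ θ (u (l * τ + τ)) - ∑ i ∈ Finset.range (p + 1), (τ ^ i / (i.factorial : ℝ)) •
            proj T k q θ₀ θ ((Lop β q)^[i] (u (l * τ)))) := by
      rw [map_sub]
      abel
    have hRe : ‖R s α τ (Lh T k q β θ₀ θ) (uh l - proj T k q θ₀ θ (u (l * τ)))‖ ≤
        (1 + μh * τ) * ‖uh l - proj T k q θ₀ θ (u (l * τ))‖ :=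
      (norm_apply_le_opNorm _ _).trans (mul_le_mul_of_nonneg_right hR (norm_nonneg _))
    rw [hsplit]
    refine (norm_sub_le _ _).trans ((add_le_add_left (norm_add_le _ _) _).trans ?_)
    have hfin : A * (p * (τ * (C₁ * (W * T.h ^ (k + 1)))) + τ ^ (p + 1) * (S * W)) +
        C₂ * (W * τ ^ (p + 1)) ≤ τ * (Q * (T.h ^ (k + 1) + τ ^ p)) := by
      have e : τ * (Q * (T.h ^ (k + 1) + τ ^ p)) -
          (A * (p * (τ * (C₁ * (W * T.h ^ (k + 1)))) + τ ^ (p + 1) * (S * W)) +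
          C₂ * (W * τ ^ (p + 1))) =
          τ * (A * (p * (C₁ * W)) * τ ^ p + (A * (S * W) + C₂ * W) * T.h ^ (k + 1)) := by
        rw [hQ]; ring
      have : 0 ≤ τ * (A * (p * (C₁ * W)) * τ ^ p + (A * (S * W) + C₂ * W) * T.h ^ (k + 1)) := by
        positivity
      linarith
    linarith
  have hgron := le_sigma_mul (e := fun l => ‖uh l - proj T k q θ₀ θ (u (l * τ))‖) (tEnd := tEnd)
    (δ := Q * (T.h ^ (k + 1) + τ ^ p)) hμ hτ.le (by positivity) (by simp [huh0]) hstep n hn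
  have hn0 := hmem n hn
  have hσ : 0 ≤ sigma μh (n * τ) := sigma_nonneg hμ hn0.1
  have h1 := l2Error_le (hu0 _ hn0 0 (by omega)).continuous (proj0 T k (u (n * τ))) (uh n)
    (fun j x hx => hproj0 a b T _ W (hu0 _ hn0 (k + 1) (by omega)).contDiff
      ((hu0 _ hn0 (k + 1) (by omega)).bound _ le_rfl) j x hx)
  have h2 : ‖proj0 T k (u (n * τ)) - uh n‖ ≤ C₁ * (W * T.h ^ (k + 1)) +
      sigma μh (n * τ) * (Q * (T.h ^ (k + 1) + τ ^ p)) := by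
    have h3 := hproj T _ W (hu0 _ hn0 (k + q) le_rfl)
    calc ‖proj0 T k (u (n * τ)) - uh n‖
        = ‖(proj T k q θ₀ θ (u (n * τ)) - proj0 T k (u (n * τ))) +
          (uh n - proj T k q θ₀ θ (u (n * τ)))‖ := by
          rw [← norm_neg]; congr 1; abel
      _ ≤ _ := (norm_add_le _ _).trans (add_le_add h3 hgron)
  refine h1.trans ?_
  set H := T.h ^ (k + 1) with hH
  set σ := sigma μh (n * τ) with hσdef
  have hX : 0 ≤ √(b - a) * (C₃ * W) + C₁ * W := by positivity
  have e : (2 * (√(b - a) * (C₃ * W) + C₁ * W + Q) + 1) * (σ + 1) * (H + τ ^ p) -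
      2 * (√(b - a) * (C₃ * (W * H)) + (C₁ * (W * H) + σ * (Q * (H + τ ^ p)))) =
      2 * (√(b - a) * (C₃ * W) + C₁ * W) * (σ * (H + τ ^ p) + τ ^ p) +
      (2 * Q + (σ + 1)) * (H + τ ^ p) := by ring
  have e2 : 0 ≤ 2 * (√(b - a) * (C₃ * W) + C₁ * W) * (σ * (H + τ ^ p) + τ ^ p) +
      (2 * Q + (σ + 1)) * (H + τ ^ p) := by positivity
  linarith
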